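/- **Model.** The input is an unweighted simple undirected graph $G$ on $n \ge 1$ nodes, available both as an adjacency list (degree of a node, $i$-th neighbor of a node, in an arbitrary order of the neighbors) and as an adjacency matrix (is $\{u,v\}$ an edge?). Algorithms are randomized programs on a random access machine, fixed independently of the input; they can draw uniformly random elements of $\{0,\dots,m-1\}$, all memory is initially zero, and time is measured by logarithmic cost (each operation costs one plus the bit lengths of the numbers involved). An *adjacency oracle* for a graph $H$ is a data structure (a memory content, together with a fixed deterministic query program that does not change the memory and that may access $G$ only through its adjacency matrix) which on every query $(u,v)$ returns, in time polylogarithmic in $n$, a bit saying whether $(u,v)\in E(H)$. A *$3$-spanner* of $G$ is an edge-subgraph $H \subseteq G$ with $\mathrm{dist}_H(s,t) \le 3\,\mathrm{dist}_G(s,t)$ for all nodes $s,t$ (distances may be $\infty$). $\widetilde O(\cdot)$ hides factors $C\log^k(n+2)$, with constants $C,k$ that may depend only on the constant $c$ below. **Theorem.** For every constant $c>0$ there are a preprocessing program and a query program such that the following holds for every $n\ge 1$ and every $n$-node graph $G$. Let $D$ be the average degree of $G$, $\delta(G)$ its minimum degree, and $\delta=\max(n^{1/2},\delta(G))$. 1.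 For every real parameter $r\ge 1$ (given to the program rounded up to an integer), with probability at least $1-1/n^{c}$ the preprocessing program halts within time $$\widetilde O\bigl(nr+n\cdot\min(D/\delta,\sqrt D)\bigr)$$ and produces an adjacency oracle for a $3$-spanner $H$ of $G$ with $$|E(H)|=\widetilde O\bigl(n^2/\delta+n^2/r\bigr).$$ 2. In particular, with $r=n^{1/2}$, with probability at least $1-1/n^{c}$ the same program halts within time $\widetilde O(n^{3/2})$ and produces an adjacency oracle for a $3$-spanner of $G$ with $\widetilde O(n^{3/2})$ edges. -/

import Mathlib

/-! ## Graphs, spanners and the parameters of the input -/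

/-- An adjacency list representation of a graph on the nodes `0, …, n - 1`: for every node, the
list of its neighbours in an arbitrary order. -/
structure AdjacencyList {n : ℕ} (G : SimpleGraph (Fin n)) where
  nbrs : Fin n → List (Fin n)
  nodup : ∀ v, (nbrs v).Nodup
  mem_nbrs : ∀ v w, w ∈ nbrs v ↔ G.Adj v w

/-- `H` is a `k`-spanner of `G`: an edge-subgraph all of whose distances are at most `k` times
those of `G`. Distances are in `ℕ∞`, with value `⊤` between nodes that are not connected. -/
def IsSpanner {V : Type*} (k : ℕ) (G H : SimpleGraph V) : Prop :=
  H ≤ G ∧ ∀ s t : V, H.edist s t ≤ (k : ℕ∞) * G.edist s t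

/-- The average degree of a graph on `n` nodes. -/
noncomputable def averageDegree {n : ℕ} (G : SimpleGraph (Fin n)) [DecidableRel G.Adj] : ℝ :=
  (∑ v, (G.degree v : ℝ)) / n

/-- The maximum of `√n` and the minimum degree. -/
noncomputable def degreeFloor {n : ℕ} (G : SimpleGraph (Fin n)) [DecidableRel G.Adj] : ℝ :=
  max (Real.sqrt n) (G.minDegree : ℝ)

/-! ## Randomized random access machine with access to an input graph

A program is a finite piece of text that does not depend on the input. It works on finitely many
registers and on a memory of cells with addresses `0, 1, 2, …`, all holding natural numbers.
Time is measured by logarithmic cost: an operation is charged one unit plus the bit lengths of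
the numbers it handles. -/

/-- Arithmetic and comparison operations. -/
inductive BinOp where
  | add | sub | mul | div | lt | eq

/-- Subtraction is truncated, division is rounded down (and `a / 0 = 0`), comparisons return
`0` or `1`. -/
def BinOp.eval : BinOp → ℕ → ℕ → ℕ
  | .add, a, b => a + b
  | .sub, a, b => a - b
  | .mul, a, b => a * b
  | .div, a, b => a / b
  | .lt, a, b => if a < b then 1 else 0
  | .eq, a, b => if a = b then 1 else 0

/-- Expressions: constants, registers, memory cells, arithmetic, and the queries to the input
graph (degree of a node, `i`-th neighbour of a node, adjacency of two nodes). -/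
inductive Expr where
  | lit (k : ℕ)
  | reg (x : ℕ)
  | mem (a : Expr)
  | op (o : BinOp) (a b : Expr)
  | deg (u : Expr)
  | nbr (u i : Expr)
  | adj (u v : Expr)

/-- Commands. `rand x e` draws a uniformly random element of `{0, …, m - 1}` into register `x`,
where `m` is the value of `e`. Tests succeed if the expression is nonzero. -/
inductive Cmd where
  | skip
  | assign (x : ℕ) (e : Expr)
  | store (a e : Expr)
  | rand (x : ℕ) (e : Expr)
  | seq (c d : Cmd)
  | cond (e : Expr) (c d : Cmd)
  | loop (e : Expr) (c : Cmd)

/-- A state of the machine: registers, memory, and the time spent so far. -/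
structure MachineState where
  reg : ℕ → ℕ
  mem : ℕ → ℕ
  time : ℕ

/-- Let some time pass. -/
def MachineState.tick (s : MachineState) (t : ℕ) : MachineState :=
  { s with time := s.time + t }

/-- Degree query (`0` on numbers that are not nodes). -/
def AdjacencyList.degQuery {n : ℕ} {G : SimpleGraph (Fin n)} (L : AdjacencyList G) (u : ℕ) : ℕ :=
  if h : u < n then (L.nbrs ⟨u, h⟩).length else 0

/-- Neighbour query: the entry at position `i` (counted from `0`) of the list of `u`, and `0` if
there is no such entry. -/
def AdjacencyList.nbrQuery {n : ℕ} {G : SimpleGraph (Fin n)} (L : AdjacencyList G) (u i : ℕ) : ℕ :=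
  if h : u < n then
    match (L.nbrs ⟨u, h⟩)[i]? with
    | some w => (w : ℕ)
    | none => 0
  else 0

open Classical in
/-- Query to the adjacency matrix (`0` on numbers that are not nodes). -/
noncomputable def adjQuery {n : ℕ} (G : SimpleGraph (Fin n)) (u v : ℕ) : ℕ :=
  if ∃ (hu : u < n) (hv : v < n), G.Adj ⟨u, hu⟩ ⟨v, hv⟩ then 1 else 0

/-- The value of an expression. -/
noncomputable def Expr.eval {n : ℕ} {G : SimpleGraph (Fin n)} (L : AdjacencyList G)
    (s : MachineState) : Expr → ℕ
  | .lit k => k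
  | .reg x => s.reg x
  | .mem a => s.mem (a.eval L s)
  | .op o a b => o.eval (a.eval L s) (b.eval L s)
  | .deg u => L.degQuery (u.eval L s)
  | .nbr u i => L.nbrQuery (u.eval L s) (i.eval L s)
  | .adj u v => adjQuery G (u.eval L s) (v.eval L s)

/-- The time for evaluating an expression: every operation and every access in it costs one plus
the bit length of its result, in addition to the cost of its arguments. -/
noncomputable def Expr.cost {n : ℕ} {G : SimpleGraph (Fin n)} (L : AdjacencyList G)
    (s : MachineState) : Expr → ℕ
  | .lit k => 1 + Nat.size k
  | .reg x => 1 + Nat.size (s.reg x)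
  | .mem a => a.cost L s + 1 + Nat.size ((Expr.mem a).eval L s)
  | .op o a b => a.cost L s + b.cost L s + 1 + Nat.size ((Expr.op o a b).eval L s)
  | .deg u => u.cost L s + 1 + Nat.size ((Expr.deg u).eval L s)
  | .nbr u i => u.cost L s + i.cost L s + 1 + Nat.size ((Expr.nbr u i).eval L s)
  | .adj u v => u.cost L s + v.cost L s + 1 + Nat.size ((Expr.adj u v).eval L s)

/-- A uniformly random element of `{0, …, m - 1}`, and `0` if `m = 0`. -/
noncomputable def uniformBelow (m : ℕ) : PMF ℕ :=
  if h : m = 0 then PMF.pure 0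
  else PMF.uniformOfFinset (Finset.range m) (Finset.nonempty_range_iff.mpr h)

/-- Run `body` while `test` succeeds. `none` is the outcome of running out of fuel. -/
noncomputable def loopExec (test : MachineState → Bool) (testCost : MachineState → ℕ)
    (body : MachineState → PMF (Option MachineState)) :
    ℕ → MachineState → PMF (Option MachineState)
  | 0, _ => PMF.pure none
  | k + 1, s =>
    let s' := s.tick (1 + testCost s)
    if test s then
      (body s').bind fun o => match o with
        | none => PMF.pure none
        | some t => loopExec test testCost body k t
    else PMF.pure (some s')

/-- The distribution of the outcome of a command. The fuel bounds the number of tests in each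
execution of a loop, so that executions that do not halt have an outcome too (`none`); an outcome
`some t` comes from an execution that halts in state `t`, whatever the fuel. -/
noncomputable def Cmd.exec {n : ℕ} {G : SimpleGraph (Fin n)} (L : AdjacencyList G) (fuel : ℕ) :
    Cmd → MachineState → PMF (Option MachineState)
  | .skip, s => PMF.pure (some (s.tick 1))
  | .assign x e, s =>
    PMF.pure (some { s.tick (1 + e.cost L s) with reg := Function.update s.reg x (e.eval L s) })
  | .store a e, s =>
    PMF.pure (some { s.tick (1 + a.cost L s + e.cost L s) with
      mem := Function.update s.mem (a.eval L s) (e.eval L s) })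
  | .rand x e, s =>
    (uniformBelow (e.eval L s)).map fun i =>
      some { s.tick (1 + e.cost L s) with reg := Function.update s.reg x i }
  | .seq c d, s =>
    (c.exec L fuel s).bind fun o => match o with
      | none => PMF.pure none
      | some t => d.exec L fuel t
  | .cond e c d, s =>
    if e.eval L s ≠ 0 then c.exec L fuel (s.tick (1 + e.cost L s))
    else d.exec L fuel (s.tick (1 + e.cost L s))
  | .loop e c, s =>
    loopExec (fun t => decide (e.eval L t ≠ 0)) (fun t => e.cost L t)
      (fun t => c.exec L fuel t) fuel s

/-- Probability of an event. -/
noncomputable def PMF.prob {α : Type*} (p : PMF α) (S : Set α) : ℝ :=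
  (p.toOuterMeasure S).toReal

/-! ## Adjacency oracles -/

/-- The expression accesses the input graph only through its adjacency matrix. -/
def Expr.OnlyAdj : Expr → Prop
  | .lit _ => True
  | .reg _ => True
  | .mem a => a.OnlyAdj
  | .op _ a b => a.OnlyAdj ∧ b.OnlyAdj
  | .deg _ => False
  | .nbr _ _ => False
  | .adj u v => u.OnlyAdj ∧ v.OnlyAdj

/-- Programs that may serve for queries: they are deterministic, do not change the memory, and
access the input graph only through its adjacency matrix. -/
def Cmd.IsQuery : Cmd → Prop
  | .skip => True
  | .assign _ e => e.OnlyAdj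
  | .store _ _ => False
  | .rand _ _ => False
  | .seq c d => c.IsQuery ∧ d.IsQuery
  | .cond e c d => e.OnlyAdj ∧ c.IsQuery ∧ d.IsQuery
  | .loop e c => e.OnlyAdj ∧ c.IsQuery

/-- Registers `0` and `1` hold `a` and `b`; the other registers are zero; the clock is zero. -/
def startState (mem : ℕ → ℕ) (a b : ℕ) : MachineState where
  reg := fun x => if x = 0 then a else if x = 1 then b else 0
  mem := mem
  time := 0

/-- The memory content `mem` together with the program `query` is an adjacency oracle for `H` with
query time at most `T`: started on this memory with a pair of nodes, the program halts within time
`T` with the corresponding entry of the adjacency matrix of `H` in register `0`. -/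
def IsAdjacencyOracle {n : ℕ} {G : SimpleGraph (Fin n)} (L : AdjacencyList G) (query : Cmd)
    (mem : ℕ → ℕ) (H : SimpleGraph (Fin n)) (T : ℝ) : Prop :=
  query.IsQuery ∧
  ∀ u v : Fin n, ∃ (fuel : ℕ) (t : MachineState),
    query.exec L fuel (startState mem u v) = PMF.pure (some t) ∧
    (t.time : ℝ) ≤ T ∧ (t.reg 0 = 1 ∧ H.Adj u v ∨ t.reg 0 = 0 ∧ ¬ H.Adj u v)

/-- With probability at least `p`, the program `prep`, run on the graph given by `L` with the
number `n` of nodes in register `0`, the parameter `r` (rounded up) in register `1` and everything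
else zero, halts within time `T` and leaves in memory an adjacency oracle, with query program
`query` and query time at most `Q`, for a `k`-spanner of the graph with at most `M` edges. -/
def BuildsSpannerOracle {n : ℕ} {G : SimpleGraph (Fin n)} (L : AdjacencyList G)
    (prep query : Cmd) (r : ℝ) (k : ℕ) (p T Q M : ℝ) : Prop :=
  ∃ fuel : ℕ,
    p ≤ (prep.exec L fuel (startState (fun _ => 0) n ⌈r⌉₊)).prob
      {o | ∃ s : MachineState, o = some s ∧ (s.time : ℝ) ≤ T ∧
        ∃ H : SimpleGraph (Fin n), IsAdjacencyOracle L query s.mem H Q ∧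
          IsSpanner k G H ∧ (H.edgeSet.ncard : ℝ) ≤ M}

open scoped ENNReal

/-! ## Expected values of programs -/

/-! The oracle describes a clustering spanner whose edges are recognised on demand and never written
down. About `(n/δ) log n` centres are drawn at random, and every node joins the first centre of the
sample adjacent to it. Every node `v` of degree at least `√n` then draws about `r log n` random
neighbours, and for every cluster among them a table remembers one drawn neighbour. An edge `{v,u}`
is kept by `v` if `u` is the centre of `v`, if `u` is the neighbour that `v` remembers in the
cluster of `u`, or if `deg v ≤ deg u` and `v` remembers nobody in the cluster of `u` (in particular
if `u` has no centre). This is decided from a constant number of memory cells and one adjacency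
query.

Stretch holds whatever the random choices (`isSpanner_keptGraph`). Take an edge `{v,u}` with `deg v
≤ deg u`. If `v` does not keep it, then `v` remembers some `w` in the cluster of `u`, and `v, w,
centre, u` is a path of kept edges.

Size (`card_marks_le`, `card_unhit_le`, `ncard_keptGraph_le`): the first two kinds give at most `1 +
k` edges per node, with `k` the number of centres. For the third kind let `d = deg v ≥ √n` and let
`ρ = min(n, r)`. Only neighbours of degree at least `d` count. With high probability they all see a
centre among the first `K (n/d + 1)` samples, where `K` is of order `log n`, so the first-centre
rule puts them into that many clusters only. A cluster with at least `d/ρ` neighbours of `v` is hit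
by `K ρ` probes with high probability, so the missed clusters contribute at most `2 K n/ρ` edges in
total. A node of degree below `√n` is charged all its edges; if there is one, then `δ = √n`, so its
degree is at most `n/δ`.

Time: the expensive part besides the `n ρ K` probes is listing the neighbours of all centres. Its
expected cost `k D` is of order at most `K (n D/δ + n)`, and an exponential moment gives
concentration (`sum_le_of_prod_le`). The minimum in the theorem is always `D/δ`
(`min_averageDegree_eq`).

Probabilities are computed by a weakest-precondition calculus `wp` for expectations, in which not
halting has value `⊤`. The failure indicator is carried backwards through the program by potentials:
a sum over bad events, each a product over the draws made so far times the averages of the draws to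
come. With `K = A · (bit length of n)`, each of at most `(n+1)^2` bad events has weight `2^{-K}`,
and `A ≥ c + 4` suffices. -/

/-- The number of nodes of the syntax tree. -/
def Expr.nodes : Expr → ℕ
  | .lit _ => 1
  | .reg _ => 1
  | .mem a => a.nodes + 1
  | .op _ a b => a.nodes + b.nodes + 1
  | .deg u => u.nodes + 1
  | .nbr u i => u.nodes + i.nodes + 1
  | .adj u v => u.nodes + v.nodes + 1

/-- All values arising in the evaluation of an expression are at most `V`. -/
def Expr.Bdd {n : ℕ} {G : SimpleGraph (Fin n)} (L : AdjacencyList G) (V : ℕ)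
    (s : MachineState) : Expr → Prop
  | .lit k => k ≤ V
  | .reg x => s.reg x ≤ V
  | .mem a => a.Bdd L V s ∧ s.mem (a.eval L s) ≤ V
  | .op o a b => a.Bdd L V s ∧ b.Bdd L V s ∧ o.eval (a.eval L s) (b.eval L s) ≤ V
  | .deg u => u.Bdd L V s ∧ L.degQuery (u.eval L s) ≤ V
  | .nbr u i => u.Bdd L V s ∧ i.Bdd L V s ∧ L.nbrQuery (u.eval L s) (i.eval L s) ≤ V
  | .adj u v => u.Bdd L V s ∧ v.Bdd L V s ∧ adjQuery G (u.eval L s) (v.eval L s) ≤ V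

section Logic

variable {n : ℕ} {G : SimpleGraph (Fin n)} {L : AdjacencyList G} {F V : ℕ}

theorem Expr.Bdd.cost_le {s : MachineState} {e : Expr} (h : e.Bdd L V s) :
    e.cost L s ≤ (V.size + 1) * e.nodes := by
  have key : ∀ x ≤ V, Nat.size x ≤ V.size := fun x hx => Nat.size_le_size hx
  induction e with
  | lit k => simp only [Expr.cost, Expr.nodes]; have := key _ h; omega
  | reg x => simp only [Expr.cost, Expr.nodes]; have := key _ h; omega
  | mem a iha =>
    have h1 := iha h.1
    have h2 := key _ h.2
    simp only [Expr.cost, Expr.nodes, Expr.eval, mul_add]; omega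
  | deg a iha =>
    have h1 := iha h.1
    have h2 := key _ h.2
    simp only [Expr.cost, Expr.nodes, Expr.eval, mul_add]; omega
  | op o a b iha ihb =>
    have h1 := iha h.1
    have h2 := ihb h.2.1
    have h3 := key _ h.2.2
    simp only [Expr.cost, Expr.nodes, Expr.eval, mul_add]; omega
  | nbr a b iha ihb =>
    have h1 := iha h.1
    have h2 := ihb h.2.1
    have h3 := key _ h.2.2
    simp only [Expr.cost, Expr.nodes, Expr.eval, mul_add]; omega
  | adj a b iha ihb =>
    have h1 := iha h.1
    have h2 := ihb h.2.1
    have h3 := key _ h.2.2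
    simp only [Expr.cost, Expr.nodes, Expr.eval, mul_add]; omega

/-- The expectation of `f` on outcomes, where not halting counts as `⊤`. -/
noncomputable def expect (p : PMF (Option MachineState)) (f : MachineState → ℝ≥0∞) : ℝ≥0∞ :=
  ∑' o, p o * o.elim ⊤ f

theorem expect_pure_some (s : MachineState) (f : MachineState → ℝ≥0∞) :
    expect (PMF.pure (some s)) f = f s := by
  unfold expect
  rw [tsum_eq_single (some s)]
  · simp
  · intro o ho; simp [PMF.pure_apply, ho]

theorem expect_bind (p : PMF (Option MachineState))
    (q : MachineState → PMF (Option MachineState)) (f : MachineState → ℝ≥0∞) :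
    expect (p.bind fun o => match o with
      | none => PMF.pure none
      | some t => q t) f = expect p fun t => expect (q t) f := by
  unfold expect
  simp only [PMF.bind_apply, ← ENNReal.tsum_mul_right]
  rw [ENNReal.tsum_comm]
  refine tsum_congr fun o => ?_
  simp only [mul_assoc, ENNReal.tsum_mul_left]
  congr 1
  cases o with
  | none =>
    rw [tsum_eq_single none]
    · simp
    · intro o ho; simp [PMF.pure_apply, ho]
  | some t => rfl

/-- The expectation of `f` after running a command. -/
noncomputable def wp (L : AdjacencyList G) (F : ℕ) (c : Cmd) (f : MachineState → ℝ≥0∞)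
    (s : MachineState) : ℝ≥0∞ :=
  expect (c.exec L F s) f

/-! ### Proof rules for the individual commands. -/

theorem wp_skip_le {f : MachineState → ℝ≥0∞} {s : MachineState} {b : ℝ≥0∞}
    (h : f ⟨s.reg, s.mem, s.time + 1⟩ ≤ b) : wp L F .skip f s ≤ b := by
  unfold wp Cmd.exec
  rw [expect_pure_some]; exact h

theorem wp_assign_le (V : ℕ) {x : ℕ} {e : Expr} {f : MachineState → ℝ≥0∞} {s : MachineState}
    {b : ℝ≥0∞} (hB : e.Bdd L V s)
    (h : ∀ τ ≤ s.time + (V.size + 1) * (e.nodes + 1),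
      f ⟨Function.update s.reg x (e.eval L s), s.mem, τ⟩ ≤ b) :
    wp L F (.assign x e) f s ≤ b := by
  unfold wp Cmd.exec
  rw [expect_pure_some]
  refine h _ ?_
  have := hB.cost_le
  simp only [MachineState.tick, mul_add]; omega

theorem wp_store_le (V : ℕ) {a e : Expr} {f : MachineState → ℝ≥0∞} {s : MachineState}
    {b : ℝ≥0∞} (hA : a.Bdd L V s) (hB : e.Bdd L V s)
    (h : ∀ τ ≤ s.time + (V.size + 1) * (a.nodes + e.nodes + 1),
      f ⟨s.reg, Function.update s.mem (a.eval L s) (e.eval L s), τ⟩ ≤ b) :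
    wp L F (.store a e) f s ≤ b := by
  unfold wp Cmd.exec
  rw [expect_pure_some]
  refine h _ ?_
  have := hA.cost_le
  have := hB.cost_le
  simp only [MachineState.tick, mul_add]; omega

theorem wp_seq (c d : Cmd) (f : MachineState → ℝ≥0∞) (s : MachineState) :
    wp L F (.seq c d) f s = wp L F c (wp L F d f) s := by
  unfold wp
  rw [Cmd.exec]
  exact expect_bind _ (fun t => d.exec L F t) f

theorem wp_cond_le (V : ℕ) {e : Expr} {c d : Cmd} {f : MachineState → ℝ≥0∞} {s : MachineState}
    {b : ℝ≥0∞} (hB : e.Bdd L V s)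
    (h1 : e.eval L s ≠ 0 → ∀ τ ≤ s.time + (V.size + 1) * (e.nodes + 1),
      wp L F c f ⟨s.reg, s.mem, τ⟩ ≤ b)
    (h2 : e.eval L s = 0 → ∀ τ ≤ s.time + (V.size + 1) * (e.nodes + 1),
      wp L F d f ⟨s.reg, s.mem, τ⟩ ≤ b) :
    wp L F (.cond e c d) f s ≤ b := by
  have ht : s.time + (1 + e.cost L s) ≤ s.time + (V.size + 1) * (e.nodes + 1) := by
    have := hB.cost_le
    rw [mul_add]; omega
  unfold wp
  rw [Cmd.exec]
  split_ifs with h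
  · exact h1 h _ ht
  · exact h2 (not_not.1 h) _ ht

/-- The premise is the statement that the average of `f` over the draw is at most `b`, cleared of
denominators. -/
theorem wp_rand_le (V : ℕ) {x : ℕ} {e : Expr} {f : MachineState → ℝ≥0∞} {s : MachineState}
    {b : ℝ≥0∞} (hB : e.Bdd L V s) (h0 : e.eval L s ≠ 0)
    (h : ∀ τ ≤ s.time + (V.size + 1) * (e.nodes + 1),
      ∑ i ∈ Finset.range (e.eval L s), f ⟨Function.update s.reg x i, s.mem, τ⟩
        ≤ (e.eval L s) * b) :
    wp L F (.rand x e) f s ≤ b := by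
  have ht : s.time + (1 + e.cost L s) ≤ s.time + (V.size + 1) * (e.nodes + 1) := by
    have := hB.cost_le
    rw [mul_add]; omega
  have h3 := h _ ht
  set m := e.eval L s with hm
  have e1 : wp L F (.rand x e) f s = ∑' i, (uniformBelow m) i *
      f ⟨Function.update s.reg x i, s.mem, s.time + (1 + e.cost L s)⟩ := by
    unfold wp expect
    rw [Cmd.exec]
    simp only [PMF.map, PMF.bind_apply, ← ENNReal.tsum_mul_right]
    rw [ENNReal.tsum_comm]
    refine tsum_congr fun i => ?_
    simp only [mul_assoc, ENNReal.tsum_mul_left]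
    congr 1
    rw [tsum_eq_single (some ⟨Function.update s.reg x i, s.mem, s.time + (1 + e.cost L s)⟩)]
    · simp [MachineState.tick]
    · intro o ho; simp [PMF.pure_apply, ho, MachineState.tick]
  rw [e1, tsum_eq_sum (s := Finset.range m)]
  · have e2 : ∀ i ∈ Finset.range m, (uniformBelow m) i *
        f ⟨Function.update s.reg x i, s.mem, s.time + (1 + e.cost L s)⟩ =
        (m : ℝ≥0∞)⁻¹ * f ⟨Function.update s.reg x i, s.mem, s.time + (1 + e.cost L s)⟩ := by
      intro i hi
      rw [uniformBelow, dif_neg h0, PMF.uniformOfFinset_apply_of_mem _ hi, Finset.card_range]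
    rw [Finset.sum_congr rfl e2, ← Finset.mul_sum]
    calc _ ≤ (m : ℝ≥0∞)⁻¹ * (m * b) := by gcongr
      _ = b := by
        rw [← mul_assoc, ENNReal.inv_mul_cancel (by exact_mod_cast h0) (by simp), one_mul]
  · intro i hi
    rw [uniformBelow, dif_neg h0, PMF.uniformOfFinset_apply_of_notMem _ hi, zero_mul]

/-- Supermartingale rule for a loop that runs exactly `N` rounds: `I j` is the invariant and `Φ j`
the potential after `j` rounds. The arbitrary `g` in `step` stands for the expectation of the
remaining rounds, of which only the bound by `Φ (j + 1)` is known. There are `N + 1` tests, hence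
the fuel condition `N < F`. -/
theorem wp_loop_le (V : ℕ) (N : ℕ) (I : ℕ → MachineState → Prop)
    (Φ : ℕ → MachineState → ℝ≥0∞) {e : Expr} {c : Cmd} {f : MachineState → ℝ≥0∞}
    {s : MachineState} (hF : N < F)
    (step : ∀ j < N, ∀ t, I j t → e.Bdd L V t ∧ e.eval L t ≠ 0 ∧
      ∀ τ ≤ t.time + (V.size + 1) * (e.nodes + 1), ∀ g : MachineState → ℝ≥0∞,
        (∀ t', I (j + 1) t' → g t' ≤ Φ (j + 1) t') → wp L F c g ⟨t.reg, t.mem, τ⟩ ≤ Φ j t)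
    (done : ∀ t, I N t → e.Bdd L V t ∧ e.eval L t = 0 ∧
      ∀ τ ≤ t.time + (V.size + 1) * (e.nodes + 1), f ⟨t.reg, t.mem, τ⟩ ≤ Φ N t)
    (init : I 0 s) : wp L F (.loop e c) f s ≤ Φ 0 s := by
  have ht : ∀ t, e.Bdd L V t →
      t.time + (1 + e.cost L t) ≤ t.time + (V.size + 1) * (e.nodes + 1) := by
    intro t hB
    have := hB.cost_le
    rw [mul_add]; omega
  have key : ∀ m j, j + m = N → ∀ fuel, m < fuel → ∀ t, I j t →
      expect (loopExec (fun t => decide (e.eval L t ≠ 0)) (fun t => e.cost L t)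
        (fun t => c.exec L F t) fuel t) f ≤ Φ j t := by
    intro m
    induction m with
    | zero =>
      intro j hj fuel hf t hI
      obtain rfl : j = N := by omega
      obtain ⟨fuel, rfl⟩ : ∃ k, fuel = k + 1 := ⟨fuel - 1, by omega⟩
      obtain ⟨h1, h2, h3⟩ := done t hI
      rw [loopExec]
      simp only [h2, ne_eq, not_true_eq_false, decide_false, Bool.false_eq_true, if_false]
      rw [expect_pure_some]
      exact h3 _ (ht t h1)
    | succ m ih =>
      intro j hj fuel hf t hI
      obtain ⟨fuel, rfl⟩ : ∃ k, fuel = k + 1 := ⟨fuel - 1, by omega⟩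
      obtain ⟨h1, h2, h3⟩ := step j (by omega) t hI
      rw [loopExec]
      simp only [h2, ne_eq, not_false_eq_true, decide_true, if_true]
      refine (expect_bind _ (fun t => loopExec (fun t => decide (e.eval L t ≠ 0))
        (fun t => e.cost L t) (fun t => c.exec L F t) fuel t) f).trans_le ?_
      exact h3 _ (ht t h1) _ fun t' ht' => ih (j + 1) (by omega) fuel (by omega) t' ht'
  unfold wp
  rw [Cmd.exec]
  exact key N 0 (by omega) F hF s init

/-- Count register `i` upwards from `0` while it is less than `e`. -/
def Cmd.forUp (i : ℕ) (e : Expr) (body : Cmd) : Cmd :=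
  .seq (.assign i (.lit 0)) (.loop (.op .lt (.reg i) e)
    (.seq body (.assign i (.op .add (.reg i) (.lit 1)))))

/-- Counting loops need only a potential depending on memory. The counter and the clock are handled
here once and for all: `upd` makes the invariant blind to the counter register, and `cb j` bounds
the time of round `j`, the overhead of tests and increments being added in `done`. -/
theorem wp_forUp_le (V : ℕ) (N : ℕ) (I : ℕ → (ℕ → ℕ) → (ℕ → ℕ) → Prop)
    (Φ : ℕ → (ℕ → ℕ) → ℝ≥0∞) (cb : ℕ → ℕ) {i : ℕ} {e : Expr} {body : Cmd}
    {f : MachineState → ℝ≥0∞} {s : MachineState} (hF : N < F) (hV : N < V)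
    (upd : ∀ j r m x, I j r m → I j (Function.update r i x) m)
    (bnd : ∀ j ≤ N, ∀ r m τ, I j r m → e.Bdd L V ⟨r, m, τ⟩ ∧ e.eval L ⟨r, m, τ⟩ = N)
    (step : ∀ j < N, ∀ r m τ, I j r m → r i = j → ∀ g : MachineState → ℝ≥0∞,
      (∀ r' m' τ', I (j + 1) r' m' → r' i = j → τ' ≤ τ + cb j → g ⟨r', m', τ'⟩ ≤ Φ (j + 1) m') →
      wp L F body g ⟨r, m, τ⟩ ≤ Φ j m)
    (init : I 0 s.reg s.mem)
    (done : ∀ r m τ, I N r m →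
      τ ≤ s.time + ∑ j ∈ Finset.range N, cb j + (V.size + 1) * (e.nodes + 8) * (N + 1) →
      f ⟨r, m, τ⟩ ≤ Φ N m) :
    wp L F (.forUp i e body) f s ≤ Φ 0 s.mem := by
  unfold Cmd.forUp
  rw [wp_seq]
  refine wp_assign_le V (by simp [Expr.Bdd]) fun τ hτ => ?_
  set W := V.size + 1 with hW
  have h1 : (1 : ℕ) ≤ V := by omega
  refine wp_loop_le V N
    (fun j t => I j t.reg t.mem ∧ t.reg i = j ∧
      t.time ≤ s.time + ∑ j ∈ Finset.range j, cb j + W * (2 + (e.nodes + 7) * j))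
    (fun j t => Φ j t.mem) hF ?_ ?_ ?_
  · rintro j hj ⟨r, m, τ⟩ ⟨h2, h3, h4⟩
    simp only at h2 h3 h4
    obtain ⟨h5, h6⟩ := bnd j hj.le r m τ h2
    refine ⟨⟨?_, h5, ?_⟩, ?_, ?_⟩
    · simp only [Expr.Bdd]; omega
    · simp only [BinOp.eval]; split_ifs <;> omega
    · simp only [Expr.eval, BinOp.eval, h3, h6, if_pos hj]; exact one_ne_zero
    intro τ' hτ' g hg
    rw [wp_seq]
    refine step j hj r m τ' h2 h3 _ fun r' m' τ'' h7 h8 h9 => ?_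
    refine wp_assign_le V ⟨?_, h1, ?_⟩ fun τ₃ hτ₃ => ?_
    · simp only [Expr.Bdd]; omega
    · simp only [Expr.eval, BinOp.eval]; omega
    · refine hg _ ⟨upd _ _ _ _ h7, ?_, ?_⟩
      · simp [Expr.eval, BinOp.eval, h8]
      · simp only [Expr.nodes] at hτ₃ hτ'
        simp only [← hW] at hτ' hτ₃ ⊢
        rw [Finset.sum_range_succ]
        have : W * (2 + (e.nodes + 7) * (j + 1)) = W * (2 + (e.nodes + 7) * j) +
          W * (1 + e.nodes + 1 + 1) + W * (1 + 1 + 1 + 1) := by ring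
        omega
  · rintro ⟨r, m, τ⟩ ⟨h2, h3, h4⟩
    simp only at h2 h3 h4
    obtain ⟨h5, h6⟩ := bnd N le_rfl r m τ h2
    refine ⟨⟨?_, h5, ?_⟩, ?_, ?_⟩
    · simp only [Expr.Bdd]; omega
    · simp only [BinOp.eval]; split_ifs <;> omega
    · simp only [Expr.eval, BinOp.eval, h3, h6, lt_irrefl, if_false]
    intro τ' hτ'
    refine done _ _ _ h2 ?_
    simp only [Expr.nodes, ← hW] at hτ'
    have : W * (e.nodes + 8) * (N + 1) = W * (2 + (e.nodes + 7) * N) +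
      W * (1 + e.nodes + 1 + 1) + W * (N + 3) := by ring
    omega
  · refine ⟨upd _ _ _ _ init, ?_, ?_⟩
    · simp [Expr.eval]
    · simp only [Expr.nodes] at hτ
      simp only [Finset.range_zero, Finset.sum_empty]
      have : W * (2 + (e.nodes + 7) * 0) = W * (1 + 1) := by ring
      omega

end Logic

/-! ## Queries to the input graph -/

section Queries

variable {n : ℕ} {G : SimpleGraph (Fin n)} (L : AdjacencyList G)

theorem AdjacencyList.degQuery_le (v : ℕ) : L.degQuery v ≤ n := by
  unfold AdjacencyList.degQuery
  split_ifs with h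
  · simpa using (L.nodup ⟨v, h⟩).length_le_card
  · exact Nat.zero_le _

theorem AdjacencyList.degQuery_eq_degree [DecidableRel G.Adj] (v : Fin n) :
    L.degQuery v = G.degree v := by
  unfold AdjacencyList.degQuery
  rw [dif_pos v.2, ← List.toFinset_card_of_nodup (L.nodup v), ← SimpleGraph.card_neighborFinset_eq_degree]
  congr 1
  ext w
  simp [L.mem_nbrs]

theorem AdjacencyList.nbrQuery_lt (hn : 0 < n) (u i : ℕ) : L.nbrQuery u i < n := by
  unfold AdjacencyList.nbrQuery
  split_ifs with h
  · split
    · exact Fin.isLt _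
    · exact hn
  · exact hn

theorem adjQuery_le_one (G : SimpleGraph (Fin n)) (u v : ℕ) : adjQuery G u v ≤ 1 := by
  unfold adjQuery; split_ifs <;> simp

theorem adjQuery_fin (G : SimpleGraph (Fin n)) (u v : Fin n) :
    adjQuery G u v = 1 ↔ G.Adj u v := by
  unfold adjQuery; simp

theorem AdjacencyList.adjQuery_nbrQuery {v i : ℕ} (hi : i < L.degQuery v) :
    adjQuery G v (L.nbrQuery v i) = 1 := by
  unfold AdjacencyList.degQuery at hi
  split_ifs at hi with h
  · have e : L.nbrQuery v i = ((L.nbrs ⟨v, h⟩)[i] : ℕ) := by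
      simp [AdjacencyList.nbrQuery, h, hi]
    rw [e]
    refine (adjQuery_fin G ⟨v, h⟩ _).2 ?_
    rw [← L.mem_nbrs]
    exact List.getElem_mem hi
  · omega

theorem AdjacencyList.exists_nbrQuery_eq_iff {v u : ℕ} :
    (∃ i < L.degQuery v, L.nbrQuery v i = u) ↔ adjQuery G v u = 1 := by
  constructor
  · rintro ⟨i, hi, rfl⟩; exact L.adjQuery_nbrQuery hi
  · intro h
    unfold adjQuery at h
    split_ifs at h with h'
    obtain ⟨hv, hu, hA⟩ := h'
    obtain ⟨i, hi, he⟩ := List.getElem_of_mem ((L.mem_nbrs _ _).2 hA)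
    refine ⟨i, ?_, ?_⟩
    · simpa [AdjacencyList.degQuery, hv] using hi
    · simp [AdjacencyList.nbrQuery, hv, hi, he]

theorem AdjacencyList.nbrQuery_injOn (v : ℕ) :
    Set.InjOn (L.nbrQuery v) (Set.Iio (L.degQuery v)) := by
  intro i hi j hj h
  simp only [Set.mem_Iio] at hi hj
  unfold AdjacencyList.degQuery at hi hj
  split_ifs at hi hj with hv
  · simp only [AdjacencyList.nbrQuery, hv, dite_true, List.getElem?_eq_getElem hi,
      List.getElem?_eq_getElem hj] at h
    exact (L.nodup _).getElem_inj_iff.1 (Fin.ext h)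
  · omega

theorem adjQuery_comm (G : SimpleGraph (Fin n)) (u v : ℕ) : adjQuery G u v = adjQuery G v u := by
  unfold adjQuery
  congr 1
  simp only [eq_iff_iff]
  constructor <;> rintro ⟨h1, h2, h3⟩ <;> exact ⟨h2, h1, h3.symm⟩

end Queries

/-! ## The programs -/

/-- The address of the table entry of node `v` for the centre with code `a`. -/
def tblIdx (v a : ℕ) : ℕ := 4 * ((v + a) * (v + a) + a) + 3

/-- With `t = v + a ≥ a`, the number `t² + a` lies in `[t², (t+1)²)`, so it determines `t` and then
`a`. The residue modulo 4 keeps the four arrays (degrees, centre codes, samples, table) apart. Since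
memory starts at zero, the table, of quadratic size, need not be initialised. -/
theorem tblIdx_inj {v a v' a' : ℕ} : tblIdx v a = tblIdx v' a' ↔ v = v' ∧ a = a' := by
  constructor
  · intro h
    unfold tblIdx at h
    have h1 : (v + a) * (v + a) + a = (v' + a') * (v' + a') + a' := by omega
    have h2 : v + a = v' + a' := by
      rcases lt_trichotomy (v + a) (v' + a') with h3 | h3 | h3
      · nlinarith
      · exact h3
      · nlinarith
    rw [h2] at h1
    omega
  · rintro ⟨rfl, rfl⟩; rfl

theorem tblIdx_mod (v a : ℕ) : tblIdx v a % 4 = 3 := by unfold tblIdx; omega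

/-- The address of the degree of a node. -/
def degAddr (v : Expr) : Expr := .op .mul (.lit 4) v

/-- The address of the code of the centre of a node. -/
def ctrAddr (v : Expr) : Expr := .op .add (.op .mul (.lit 4) v) (.lit 1)

/-- The address of a sampled centre. -/
def smpAddr (j : Expr) : Expr := .op .add (.op .mul (.lit 4) j) (.lit 2)

/-- The address of a table entry. -/
def tblAddr (v a : Expr) : Expr :=
  .op .add (.op .mul (.lit 4) (.op .add (.op .mul (.op .add v a) (.op .add v a)) a)) (.lit 3)

/-- Replace the parameter by `n` if it is larger. -/
def capCmd : Cmd := .cond (.op .lt (.reg 0) (.reg 1)) (.assign 1 (.reg 0)) .skip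

/-- Compute `A` times the bit length of `n`. -/
def logCmd (A : ℕ) : Cmd :=
  .seq (.assign 6 (.reg 0)) (.loop (.reg 6)
    (.seq (.assign 6 (.op .div (.reg 6) (.lit 2))) (.assign 2 (.op .add (.reg 2) (.lit A)))))

/-- Store all degrees, and compute the minimum of those that are at least `√n`. -/
def degCmd : Cmd :=
  .seq (.assign 4 (.reg 0)) (.forUp 3 (.reg 0)
    (.seq (.store (degAddr (.reg 3)) (.deg (.reg 3)))
      (.cond (.op .lt (.op .mul (.deg (.reg 3)) (.deg (.reg 3))) (.reg 0)) .skip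
        (.cond (.op .lt (.deg (.reg 3)) (.reg 4)) (.assign 4 (.deg (.reg 3))) .skip))))

/-- Sample the centres. -/
def sampleCmd : Cmd :=
  .seq (.assign 5 (.op .mul (.reg 2) (.op .add (.op .div (.reg 0) (.reg 4)) (.lit 1))))
    (.forUp 3 (.reg 5) (.seq (.rand 6 (.reg 0)) (.store (smpAddr (.reg 3)) (.reg 6))))

/-- Assign all neighbours of the centre in register `6` that have no centre yet to it. -/
def claimCmd : Cmd :=
  .forUp 7 (.deg (.reg 6)) (.seq (.assign 8 (.nbr (.reg 6) (.reg 7)))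
    (.cond (.mem (ctrAddr (.reg 8))) .skip
      (.store (ctrAddr (.reg 8)) (.op .add (.reg 6) (.lit 1)))))

/-- Assign every node to its first neighbour among the centres. -/
def scanCmd : Cmd :=
  .forUp 3 (.reg 5) (.seq (.assign 6 (.mem (smpAddr (.reg 3)))) claimCmd)

/-- Sample neighbours of the node in register `3`, and record them in the table entries of their
centres. -/
def probeRowCmd : Cmd :=
  .forUp 7 (.reg 5) (.seq (.rand 6 (.deg (.reg 3))) (.seq (.assign 8 (.nbr (.reg 3) (.reg 6)))
    (.seq (.assign 9 (.mem (ctrAddr (.reg 8))))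
      (.cond (.reg 9) (.store (tblAddr (.reg 3) (.reg 9)) (.op .add (.reg 8) (.lit 1))) .skip))))

/-- Sample neighbours of all nodes of degree at least `√n`. -/
def probeCmd : Cmd :=
  .seq (.assign 5 (.op .mul (.reg 2) (.reg 1))) (.forUp 3 (.reg 0)
    (.cond (.op .lt (.op .mul (.deg (.reg 3)) (.deg (.reg 3))) (.reg 0)) .skip probeRowCmd))

/-- The preprocessing program. -/
def prepCmd (A : ℕ) : Cmd :=
  .seq capCmd (.seq (logCmd A) (.seq degCmd (.seq sampleCmd (.seq scanCmd probeCmd))))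

/-! ## Correctness of the deterministic parts -/

section Deterministic

variable {n : ℕ} {G : SimpleGraph (Fin n)} {L : AdjacencyList G} {F V : ℕ}
  {f : MachineState → ℝ≥0∞} {s : MachineState} {b : ℝ≥0∞}

/-- This is the only command that meets the uncapped parameter, which may be far larger than any
polynomial in `n`. Its cost is therefore bounded linearly in the parameter, a term that `n r`
absorbs; all later numbers are polynomial in `n`. -/
theorem wp_capCmd_le (h0 : s.reg 0 = n) (post : ∀ r τ, (∀ x, x ≠ 1 → r x = s.reg x) →
      r 1 = min n (s.reg 1) → τ ≤ s.time + 8 * (n + s.reg 1 + 2) → f ⟨r, s.mem, τ⟩ ≤ b) :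
    wp L F capCmd f s ≤ b := by
  have hs : (n + s.reg 1 + 1).size ≤ n + s.reg 1 + 1 := Nat.size_le.2 Nat.lt_two_pow_self
  unfold capCmd
  refine wp_cond_le (n + s.reg 1 + 1) ?_ (fun h τ hτ => ?_) (fun h τ hτ => ?_)
  · simp only [Expr.Bdd, BinOp.eval, Expr.eval, h0]
    refine ⟨by omega, by omega, ?_⟩
    split_ifs <;> omega
  · refine wp_assign_le (n + s.reg 1 + 1) (by simp only [Expr.Bdd]; omega) fun τ' hτ' => ?_
    refine post _ _ (fun x hx => by simp [hx]) ?_ ?_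
    · simp only [Expr.eval, BinOp.eval, h0] at h ⊢
      split_ifs at h with h'
      · simp [h'.le]
      · simp at h
    · simp only [Expr.nodes] at hτ hτ'
      omega
  · refine wp_skip_le (post _ _ (fun _ _ => rfl) ?_ ?_)
    · simp only [Expr.eval, BinOp.eval, h0] at h
      split_ifs at h with h'
      simp only; omega
    · simp only [Expr.nodes] at hτ
      simp only; omega

theorem wp_logCmd_le {A : ℕ} (hF : n.size < F) (hV : n + 2 + A * n.size + A ≤ V)
    (h0 : s.reg 0 = n) (h2 : s.reg 2 = 0)
    (post : ∀ r τ, (∀ x, x ≠ 2 → x ≠ 6 → r x = s.reg x) → r 2 = A * n.size →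
      τ ≤ s.time + (V.size + 1) * (10 * (n.size + 1)) → f ⟨r, s.mem, τ⟩ ≤ b) :
    wp L F (logCmd A) f s ≤ b := by
  unfold logCmd
  rw [wp_seq]
  refine wp_assign_le V (by simp only [Expr.Bdd]; omega) fun τ hτ => ?_
  refine wp_loop_le V n.size (fun j t => t.mem = s.mem ∧ (∀ x, x ≠ 2 → x ≠ 6 → t.reg x = s.reg x)
    ∧ t.reg 2 = A * j ∧ t.reg 6 = n / 2 ^ j ∧ t.time ≤ s.time + (V.size + 1) * (10 * j + 2))
    (fun _ _ => b) hF ?_ ?_ ?_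
  · rintro j hj ⟨r, m, τ⟩ ⟨rfl, h3, h4, h5, h6⟩
    simp only at h3 h4 h5 h6
    have h7 : n / 2 ^ j ≤ n := Nat.div_le_self _ _
    refine ⟨by simp only [Expr.Bdd, h5]; omega, ?_, fun τ' hτ' g hg => ?_⟩
    · simp only [Expr.eval, h5]
      have := (Nat.lt_size.1 hj)
      exact (Nat.div_pos this (by positivity)).ne'
    have h8 : A * (j + 1) ≤ A * n.size := Nat.mul_le_mul_left _ hj
    rw [wp_seq]
    refine wp_assign_le V ?_ fun τ₂ hτ₂ => wp_assign_le V ?_ fun τ₃ hτ₃ => hg _ ?_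
    · simp only [Expr.Bdd, Expr.eval, BinOp.eval, h5]; omega
    · simp [Expr.Bdd, Expr.eval, BinOp.eval, h4]; rw [mul_add] at h8; omega
    · refine ⟨rfl, fun x hx hx' => ?_, ?_, ?_, ?_⟩
      · simp [hx, hx', h3]
      · simp [Expr.eval, BinOp.eval, h4, mul_add]
      · simp [Expr.eval, BinOp.eval, h5, Nat.div_div_eq_div_mul, pow_succ]
      · simp only [Expr.nodes] at hτ' hτ₂ hτ₃ ⊢
        have : (V.size + 1) * (10 * (j + 1) + 2) = (V.size + 1) * (10 * j + 2) +
          (V.size + 1) * 10 := by ring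
        omega
  · rintro ⟨r, m, τ⟩ ⟨rfl, h3, h4, h5, h6⟩
    simp only at h3 h4 h5 h6
    have h7 : n / 2 ^ n.size = 0 := Nat.div_eq_of_lt (Nat.lt_size_self n)
    refine ⟨by simp only [Expr.Bdd, h5]; omega, by simp only [Expr.eval, h5, h7],
      fun τ' hτ' => post _ _ h3 h4 ?_⟩
    simp only [Expr.nodes] at hτ'
    have : (V.size + 1) * (10 * (n.size + 1)) = (V.size + 1) * (10 * n.size + 2) +
          (V.size + 1) * 8 := by ring
    omega
  · refine ⟨rfl, fun x _ hx => by simp [hx], by simp [h2], by simp [Expr.eval, h0], ?_⟩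
    simp only [Expr.nodes] at hτ ⊢
    omega

/-- `m` is the minimum of the degrees that are at least `√n`, and at most `n`. -/
structure IsDegreeBound (L : AdjacencyList G) (k m : ℕ) : Prop where
  pos : 0 < m
  le : m ≤ n
  le_deg : ∀ u < k, n ≤ L.degQuery u * L.degQuery u → m ≤ L.degQuery u
  eq : m = n ∨ ∃ u < k, n ≤ L.degQuery u * L.degQuery u ∧ m = L.degQuery u

theorem wp_degCmd_le (hn : 0 < n) (hF : n < F) (hV : 16 * (n * n) + 8 * n + 8 ≤ V)
    (h0 : s.reg 0 = n)
    (post : ∀ r m τ, (∀ x, x ≠ 3 → x ≠ 4 → r x = s.reg x) → IsDegreeBound L n (r 4) →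
      (∀ v < n, m (4 * v) = L.degQuery v) → (∀ a, a % 4 ≠ 0 → m a = s.mem a) →
      τ ≤ s.time + (V.size + 1) * (40 * (n + 1)) → f ⟨r, m, τ⟩ ≤ b) :
    wp L F degCmd f s ≤ b := by
  unfold degCmd
  rw [wp_seq]
  refine wp_assign_le V (by simp only [Expr.Bdd]; omega) fun τ hτ => ?_
  refine wp_forUp_le V n (fun j r m => (∀ x, x ≠ 3 → x ≠ 4 → r x = s.reg x) ∧
    IsDegreeBound L j (r 4) ∧ (∀ v < j, m (4 * v) = L.degQuery v) ∧
    (∀ a, a % 4 ≠ 0 → m a = s.mem a)) (fun _ _ => b) (fun _ => (V.size + 1) * 24) hF (by omega)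
    ?_ ?_ ?_ ?_ ?_
  · rintro j r m x ⟨h1, h2, h3, h4⟩
    exact ⟨fun y hy hy' => by simp [hy, h1 y hy hy'], by simpa using h2, h3, h4⟩
  · rintro j hj r m τ ⟨h1, h2, h3, h4⟩
    have : r 0 = n := by rw [h1 0 (by simp) (by simp), h0]
    simp only [Expr.Bdd, Expr.eval, this, and_true]; omega
  · rintro j hj r m τ ⟨h1, h2, h3, h4⟩ h5 g hg
    have h6 : r 0 = n := by rw [h1 0 (by simp) (by simp), h0]
    have hd := L.degQuery_le j
    have hdd : L.degQuery j * L.degQuery j ≤ n * n := Nat.mul_le_mul hd hd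
    have hm4 := h2.le
    rw [wp_seq]
    refine wp_store_le V ?_ ?_ fun τ₁ hτ₁ => ?_
    · simp only [degAddr, Expr.Bdd, Expr.eval, BinOp.eval, h5]; omega
    · simp only [Expr.Bdd, Expr.eval, h5]; omega
    simp only [degAddr, Expr.eval, BinOp.eval, h5]
    have h7 : ∀ v < j + 1, Function.update m (4 * j) (L.degQuery j) (4 * v) = L.degQuery v := by
      intro v hv
      by_cases hvj : v = j
      · simp [hvj]
      · rw [Function.update_of_ne (by omega), h3 v (by omega)]
    have h8 : ∀ a, a % 4 ≠ 0 → Function.update m (4 * j) (L.degQuery j) a = s.mem a := by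
      intro a ha
      rw [Function.update_of_ne (by omega), h4 a ha]
    simp only [degAddr, Expr.nodes] at hτ₁
    refine wp_cond_le V ?_ (fun h τ₂ hτ₂ => ?_) (fun h τ₂ hτ₂ => ?_)
    · simp only [Expr.Bdd, Expr.eval, BinOp.eval, h5, h6]
      refine ⟨⟨?_, ?_, ?_⟩, ?_, ?_⟩ <;> try split_ifs
      all_goals omega
    · simp only [Expr.eval, BinOp.eval, h5, h6, ne_eq, ite_eq_right_iff, one_ne_zero, imp_false,
        not_not] at h
      simp only [Expr.nodes] at hτ₂
      refine wp_skip_le (hg _ _ _ ⟨h1, ⟨h2.pos, h2.le, fun u hu hnu => ?_, ?_⟩, h7, h8⟩ h5 ?_)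
      · rcases Nat.lt_succ_iff_lt_or_eq.1 hu with hu | rfl
        · exact h2.le_deg u hu hnu
        · omega
      · rcases h2.eq with h | ⟨u, hu, h⟩
        · exact .inl h
        · exact .inr ⟨u, by omega, h⟩
      · simp only; omega
    simp only [Expr.eval, BinOp.eval, h5, h6, ite_eq_right_iff, one_ne_zero, imp_false,
        not_lt] at h
    simp only [Expr.nodes] at hτ₂
    have hpos : 0 < L.degQuery j := by
      by_contra h'
      have : L.degQuery j = 0 := by omega
      rw [this] at h; omega
    refine wp_cond_le V ?_ (fun h' τ₃ hτ₃ => ?_) (fun h' τ₃ hτ₃ => ?_)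
    · simp only [Expr.Bdd, Expr.eval, BinOp.eval, h5]
      refine ⟨⟨?_, ?_⟩, ?_, ?_⟩ <;> try split_ifs
      all_goals omega
    · simp only [Expr.eval, BinOp.eval, h5, ne_eq, ite_eq_right_iff, one_ne_zero, imp_false,
        not_not] at h'
      simp only [Expr.nodes] at hτ₃
      refine wp_assign_le V ?_ fun τ₄ hτ₄ => ?_
      · simp only [Expr.Bdd, Expr.eval, h5]; omega
      simp only [Expr.eval, h5]
      simp only [Expr.nodes] at hτ₄
      refine hg _ _ _ ⟨fun x hx hx' => by simp [hx', h1 x hx hx'], ?_, h7, h8⟩ (by simp [h5]) ?_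
      · simp only [Function.update_self]
        refine ⟨hpos, hd, fun u hu hnu => ?_, .inr ⟨j, by omega, h, rfl⟩⟩
        rcases Nat.lt_succ_iff_lt_or_eq.1 hu with hu | rfl
        · exact h'.le.trans (h2.le_deg u hu hnu)
        · exact le_rfl
      · omega
    · simp only [Expr.eval, BinOp.eval, h5, ite_eq_right_iff, one_ne_zero, imp_false,
        not_lt] at h'
      simp only [Expr.nodes] at hτ₃
      refine wp_skip_le (hg _ _ _ ⟨h1, ⟨h2.pos, h2.le, fun u hu hnu => ?_, ?_⟩, h7, h8⟩ h5 ?_)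
      · rcases Nat.lt_succ_iff_lt_or_eq.1 hu with hu | rfl
        · exact h2.le_deg u hu hnu
        · exact h'
      · rcases h2.eq with h | ⟨u, hu, h⟩
        · exact .inl h
        · exact .inr ⟨u, by omega, h⟩
      · simp only; omega
  · refine ⟨fun x _ hx => by simp [hx], ?_, by simp, fun _ _ => rfl⟩
    simp only [Function.update_self, Expr.eval, h0]
    exact ⟨hn, le_rfl, by simp, .inl rfl⟩
  · rintro r m τ' ⟨h1, h2, h3, h4⟩ hτ'
    refine post r m τ' h1 h2 h3 h4 ?_
    simp only [Expr.nodes, Finset.sum_const, Finset.card_range, smul_eq_mul] at hτ hτ'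
    have : (V.size + 1) * (40 * (n + 1)) = (V.size + 1) * (1 + 1) + n * ((V.size + 1) * 24) +
      (V.size + 1) * (1 + 8) * (n + 1) + (V.size + 1) * (7 * n + 29) := by ring
    omega

end Deterministic

/-! ### Clustering, sampling and probing, with their potentials. -/

section Phases

variable {n : ℕ} {G : SimpleGraph (Fin n)} {L : AdjacencyList G} {F V : ℕ}
  {f : MachineState → ℝ≥0∞} {s : MachineState} {b : ℝ≥0∞}

/-- A centre `c` is stored with code `c + 1`, so that `0` means "no centre" and earlier claims are
never overwritten. The time is proportional to the degree of `c`, not to `n`. -/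
theorem wp_claimCmd_le (hn : 0 < n) (hF : n < F) (hV : 16 * (n * n) + 8 * n + 8 ≤ V)
    (hc : s.reg 6 < n) (hm : ∀ u < n, s.mem (4 * u + 1) ≤ n)
    (post : ∀ r m τ, (∀ x, x ≠ 7 → x ≠ 8 → r x = s.reg x) → (∀ a, a % 4 ≠ 1 → m a = s.mem a) →
      (∀ u < n, m (4 * u + 1) = if s.mem (4 * u + 1) = 0 ∧ adjQuery G (s.reg 6) u = 1
        then s.reg 6 + 1 else s.mem (4 * u + 1)) →
      τ ≤ s.time + (V.size + 1) * (40 * (L.degQuery (s.reg 6) + 1)) → f ⟨r, m, τ⟩ ≤ b) :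
    wp L F claimCmd f s ≤ b := by
  unfold claimCmd
  set c := s.reg 6 with hcdef
  have hd := L.degQuery_le c
  refine wp_forUp_le V (L.degQuery c) (fun j r m => (∀ x, x ≠ 7 → x ≠ 8 → r x = s.reg x) ∧
    (∀ a, a % 4 ≠ 1 → m a = s.mem a) ∧
    (∀ u < n, m (4 * u + 1) = if s.mem (4 * u + 1) = 0 ∧ ∃ i < j, L.nbrQuery c i = u
        then c + 1 else s.mem (4 * u + 1)))
    (fun _ _ => b) (fun _ => (V.size + 1) * 24) (by omega) (by omega) ?_ ?_ ?_ ?_ ?_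
  · rintro j r m x ⟨h1, h2, h3⟩
    exact ⟨fun y hy hy' => by simp [hy, h1 y hy hy'], h2, h3⟩
  · rintro j hj r m τ ⟨h1, h2, h3⟩
    have : r 6 = c := h1 6 (by simp) (by simp)
    simp only [Expr.Bdd, Expr.eval, this, and_true]; omega
  · rintro j hj r m τ ⟨h1, h2, h3⟩ h5 g hg
    have h6 : r 6 = c := h1 6 (by simp) (by simp)
    have hu := L.nbrQuery_lt hn c j
    set u := L.nbrQuery c j with hudef
    have hmu : m (4 * u + 1) ≤ n := by
      rw [h3 u hu]
      have := hm u hu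
      split_ifs <;> omega
    rw [wp_seq]
    refine wp_assign_le V ?_ fun τ₁ hτ₁ => ?_
    · simp only [Expr.Bdd, Expr.eval, h5, h6, ← hudef]; omega
    simp only [Expr.eval, h5, h6, ← hudef]
    simp only [Expr.nodes] at hτ₁
    have key : ∀ w < n, w ≠ u → ((∃ i < j + 1, L.nbrQuery c i = w) ↔
        ∃ i < j, L.nbrQuery c i = w) := by
      intro w _ hwu
      constructor
      · rintro ⟨i, hi, rfl⟩
        refine ⟨i, ?_, rfl⟩
        rcases Nat.lt_succ_iff_lt_or_eq.1 hi with hi | rfl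
        · exact hi
        · exact absurd rfl hwu
      · rintro ⟨i, hi, rfl⟩; exact ⟨i, by omega, rfl⟩
    have key' : ∃ i < j + 1, L.nbrQuery c i = u := ⟨j, by omega, rfl⟩
    refine wp_cond_le V ?_ (fun h τ₂ hτ₂ => ?_) (fun h τ₂ hτ₂ => ?_)
    · simp only [ctrAddr, Expr.Bdd, Expr.eval, BinOp.eval, Function.update_self]
      omega
    · simp only [ctrAddr, Expr.eval, BinOp.eval, Function.update_self] at h
      simp only [ctrAddr, Expr.nodes] at hτ₂
      refine wp_skip_le (hg _ _ _ ⟨fun x hx hx' => by simp [hx', h1 x hx hx'], h2, ?_⟩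
        (by simp [h5]) (by simp only; omega))
      intro w hw
      change m (4 * w + 1) = _
      rw [h3 w hw]
      by_cases hwu : w = u
      · rw [h3 u hu] at h
        rw [hwu]
        by_cases h0 : s.mem (4 * u + 1) = 0
        · simp only [h0, true_and, ne_eq, ite_eq_right_iff, not_forall] at h
          obtain ⟨h, -⟩ := h
          rw [if_pos ⟨h0, h⟩, if_pos ⟨h0, key'⟩]
        · simp [h0]
      · simp only [key w hw hwu]
    · simp only [ctrAddr, Expr.eval, BinOp.eval, Function.update_self] at h
      simp only [ctrAddr, Expr.nodes] at hτ₂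
      refine wp_store_le V ?_ ?_ fun τ₃ hτ₃ => ?_
      · simp only [ctrAddr, Expr.Bdd, Expr.eval, BinOp.eval, Function.update_self]
        omega
      · simp [Expr.Bdd, Expr.eval, BinOp.eval, h6]
        omega
      simp only [ctrAddr, Expr.nodes] at hτ₃
      have e6 : Function.update r 8 u 6 = c := by simp [h6]
      simp only [ctrAddr, Expr.eval, BinOp.eval, Function.update_self, e6]
      refine hg _ _ _ ⟨fun x hx hx' => by simp [hx', h1 x hx hx'], ?_, ?_⟩
        (by simp [h5]) (by omega)
      · intro a ha
        rw [Function.update_of_ne (by omega), h2 a ha]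
      · intro w hw
        by_cases hwu : w = u
        · rw [h3 u hu] at h
          have h0 : s.mem (4 * u + 1) = 0 := by
            split_ifs at h with h'
            exact h
          rw [hwu, if_pos ⟨h0, key'⟩]; simp
        · rw [Function.update_of_ne (by omega), h3 w hw]; simp only [key w hw hwu]
  · exact ⟨fun x hx _ => rfl, fun _ _ => rfl, by simp⟩
  · rintro r m τ' ⟨h1, h2, h3⟩ hτ'
    simp only [L.exists_nbrQuery_eq_iff] at h3
    refine post r m τ' h1 h2 h3 ?_
    simp only [Expr.nodes, Finset.sum_const, Finset.card_range, smul_eq_mul] at hτ'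
    have : (V.size + 1) * (40 * (L.degQuery c + 1)) = L.degQuery c * ((V.size + 1) * 24) +
      (V.size + 1) * (1 + 1 + 8) * (L.degQuery c + 1) +
      (V.size + 1) * (6 * L.degQuery c + 30) := by ring
    omega

/-- The memory assigns every node to its first neighbour among the first `k` samples. -/
def CentersAssigned (G : SimpleGraph (Fin n)) (k : ℕ) (m : ℕ → ℕ) : Prop :=
  ∀ u < n, (m (4 * u + 1) = 0 ∧ ∀ i < k, adjQuery G (m (4 * i + 2)) u ≠ 1) ∨
    ∃ i < k, m (4 * u + 1) = m (4 * i + 2) + 1 ∧ adjQuery G (m (4 * i + 2)) u = 1 ∧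
      ∀ i' < i, adjQuery G (m (4 * i' + 2)) u ≠ 1

/-- Samples are processed in order and claims are final, so each node ends up with its first
adjacent sample. The bound on the time still contains the random sum of the degrees of the samples.
-/
theorem wp_scanCmd_le {k : ℕ} (hn : 0 < n) (hF : n < F) (hkF : k < F)
    (hV : 16 * (n * n) + 8 * n + 8 ≤ V) (hkV : 4 * k + 4 ≤ V)
    (h5 : s.reg 5 = k) (hS : ∀ j < k, s.mem (4 * j + 2) < n) (hC : ∀ u < n, s.mem (4 * u + 1) = 0)
    (post : ∀ r m τ, (∀ x, x ≠ 3 → x ≠ 6 → x ≠ 7 → x ≠ 8 → r x = s.reg x) →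
      (∀ a, a % 4 ≠ 1 → m a = s.mem a) → CentersAssigned G k m →
      τ ≤ s.time + (V.size + 1) * (80 * (∑ j ∈ Finset.range k, L.degQuery (s.mem (4 * j + 2))
        + k + 1)) → f ⟨r, m, τ⟩ ≤ b) :
    wp L F scanCmd f s ≤ b := by
  unfold scanCmd
  refine wp_forUp_le V k (fun j r m => (∀ x, x ≠ 3 → x ≠ 6 → x ≠ 7 → x ≠ 8 → r x = s.reg x) ∧
    (∀ a, a % 4 ≠ 1 → m a = s.mem a) ∧ CentersAssigned G j m) (fun _ _ => b)
    (fun j => (V.size + 1) * (40 * (L.degQuery (s.mem (4 * j + 2)) + 1) + 10)) hkF (by omega)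
    ?_ ?_ ?_ ?_ ?_
  · rintro j r m x ⟨h1, h2, h3⟩
    exact ⟨fun y hy hy' => by simp [hy]; exact h1 y hy hy', h2, h3⟩
  · rintro j hj r m τ ⟨h1, h2, h3⟩
    have : r 5 = k := by rw [h1 5 (by simp) (by simp) (by simp) (by simp), h5]
    simp only [Expr.Bdd, Expr.eval, this, and_true]; omega
  · rintro j hj r m τ ⟨h1, h2, h3⟩ hj3 g hg
    have hmS : ∀ i, m (4 * i + 2) = s.mem (4 * i + 2) := fun i => h2 _ (by omega)
    have hSj := hS j hj
    rw [wp_seq]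
    refine wp_assign_le V ?_ fun τ₁ hτ₁ => ?_
    · simp only [smpAddr, Expr.Bdd, Expr.eval, BinOp.eval, hj3, hmS]; omega
    simp only [smpAddr, Expr.eval, BinOp.eval, hj3, hmS]
    simp only [smpAddr, Expr.nodes] at hτ₁
    refine wp_claimCmd_le hn hF hV (by simpa using hSj) ?_ ?_
    · intro u hu
      simp only
      rcases h3 u hu with h | ⟨i, hi, h, -⟩
      · omega
      · rw [h, hmS]
        have := hS i (by omega)
        omega
    · intro r' m' τ' h4 h6 h7 h8
      simp only [Function.update_self] at h4 h6 h7 h8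
      have hmS' : ∀ i, m' (4 * i + 2) = s.mem (4 * i + 2) :=
        fun i => by rw [h6 _ (by omega), hmS]
      refine hg _ _ _ ⟨fun x hx hx' hx2 hx3 => ?_, fun a ha => by rw [h6 a ha, h2 a ha], ?_⟩ ?_ ?_
      · rw [h4 x hx2 hx3, Function.update_of_ne hx', h1 x hx hx' hx2 hx3]
      · intro u hu
        rw [h7 u hu]
        simp only [hmS']
        rcases h3 u hu with ⟨h, h'⟩ | ⟨i, hi, h, h', h''⟩
        · simp only [hmS] at h'
          by_cases hA : adjQuery G (s.mem (4 * j + 2)) u = 1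
          · right
            exact ⟨j, by omega, by simp [h, hA], hA, h'⟩
          · left
            refine ⟨by simp [h, hA], fun i hi => ?_⟩
            rcases Nat.lt_succ_iff_lt_or_eq.1 hi with hi | rfl
            · exact h' i hi
            · exact hA
        · right
          simp only [hmS] at h h' h''
          exact ⟨i, by omega, by simp [h], h', h''⟩
      · rw [h4 3 (by simp) (by simp)]; simp [hj3]
      · have : (V.size + 1) * (40 * (L.degQuery (s.mem (4 * j + 2)) + 1) + 10) =
          (V.size + 1) * (40 * (L.degQuery (s.mem (4 * j + 2)) + 1)) + (V.size + 1) * 10 := by ring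
        omega
  · exact ⟨fun x _ _ _ _ => rfl, fun _ _ => rfl, fun u hu => .inl ⟨hC u hu, by simp⟩⟩
  · rintro r m τ' ⟨h1, h2, h3⟩ hτ'
    refine post r m τ' h1 h2 h3 (hτ'.trans ?_)
    simp only [Expr.nodes, ← Finset.mul_sum, Finset.sum_add_distrib, Finset.sum_const,
      Finset.card_range, smul_eq_mul]
    generalize ∑ j ∈ Finset.range k, L.degQuery (s.mem (4 * j + 2)) = D
    nlinarith [Nat.zero_le ((V.size + 1) * D), Nat.zero_le ((V.size + 1) * k)]

/-- The bad events of the sampling are given abstractly: event `x` is dominated by `w x` times a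
product of factors `g x i`, one for each draw, whose average over a uniform draw is at most `q x i`.
Independence of the draws then turns the product into `∏ q x i`. -/
theorem wp_sampleCmd_le {K mm k : ℕ} (hn : 0 < n) (hkF : k < F)
    (hV : 16 * (n * n) + 8 * n + 8 ≤ V) (hkV : 4 * k + 4 ≤ V) (hKV : K ≤ V)
    (h0 : s.reg 0 = n) (h2 : s.reg 2 = K) (h4 : s.reg 4 = mm) (hmm : mm ≤ n)
    (hk : k = K * (n / mm + 1))
    {ι : Type*} (X : Finset ι) (w : ι → ℝ≥0∞) (g : ι → ℕ → ℕ → ℝ≥0∞) (q : ι → ℕ → ℝ≥0∞)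
    (hq : ∀ x ∈ X, ∀ i < k, ∑ c ∈ Finset.range n, g x i c ≤ n * q x i)
    (post : ∀ r m τ, (∀ x, x ≠ 3 → x ≠ 5 → x ≠ 6 → r x = s.reg x) → r 5 = k →
      (∀ a, a % 4 ≠ 2 → m a = s.mem a) → (∀ j < k, m (4 * j + 2) < n) →
      τ ≤ s.time + (V.size + 1) * (40 * (k + 1)) →
      f ⟨r, m, τ⟩ ≤ b + ∑ x ∈ X, w x * ∏ i ∈ Finset.range k, g x i (m (4 * i + 2))) :
    wp L F sampleCmd f s ≤ b + ∑ x ∈ X, w x * ∏ i ∈ Finset.range k, q x i := by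
  unfold sampleCmd
  rw [wp_seq]
  have hdiv : n / mm ≤ n := Nat.div_le_self _ _
  refine wp_assign_le V ?_ fun τ hτ => ?_
  · simp only [Expr.Bdd, Expr.eval, BinOp.eval, h0, h2, h4, ← hk]
    omega
  simp only [Expr.eval, BinOp.eval, h0, h2, h4, ← hk]
  simp only [Expr.nodes] at hτ
  -- After `j` draws the first `j` factors are evaluated at the samples in memory and the others are
  -- replaced by their averages.
  set Φ : ℕ → (ℕ → ℕ) → ℝ≥0∞ := fun j m => b + ∑ x ∈ X, w x *
    ((∏ i ∈ Finset.range j, g x i (m (4 * i + 2))) * ∏ i ∈ Finset.Ico j k, q x i) with hΦ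
  have hΦ0 : b + ∑ x ∈ X, w x * ∏ i ∈ Finset.range k, q x i = Φ 0 s.mem := by
    simp [hΦ]
  rw [hΦ0]
  refine wp_forUp_le V k (fun j r m => (∀ x, x ≠ 3 → x ≠ 5 → x ≠ 6 → r x = s.reg x) ∧ r 5 = k ∧
    (∀ a, a % 4 ≠ 2 → m a = s.mem a) ∧ (∀ i < j, m (4 * i + 2) < n)) Φ
    (fun j => (V.size + 1) * 20) hkF (by omega) ?_ ?_ ?_ ?_ ?_
  · rintro j r m x ⟨h1, h2, h3, h4⟩
    exact ⟨fun y hy hy' => by simp [hy]; exact h1 y hy hy', by simpa using h2, h3, h4⟩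
  · rintro j hj r m τ ⟨h1, h2, h3, h4⟩
    simp only [Expr.Bdd, Expr.eval, h2, and_true]; omega
  · rintro j hj r m τ₀ ⟨h6, h7, h8, h9⟩ hj3 g' hg
    have hr0 : r 0 = n := by rw [h6 0 (by simp) (by simp) (by simp), h0]
    rw [wp_seq]
    refine wp_rand_le V ?_ ?_ fun τ₁ hτ₁ => ?_
    · simp only [Expr.Bdd, hr0]; omega
    · simp only [Expr.eval, hr0]; omega
    simp only [Expr.eval, hr0]
    simp only [Expr.nodes] at hτ₁
    have step : ∀ c ∈ Finset.range n,
        wp L F (.store (smpAddr (.reg 3)) (.reg 6)) g' ⟨Function.update r 6 c, m, τ₁⟩ ≤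
        b + ∑ x ∈ X, w x * ((∏ i ∈ Finset.range j, g x i (m (4 * i + 2))) *
          ∏ i ∈ Finset.Ico (j + 1) k, q x i) * g x j c := by
      intro c hc
      rw [Finset.mem_range] at hc
      have e3 : Function.update r 6 c 3 = j := by simp [hj3]
      refine wp_store_le V ?_ ?_ fun τ₂ hτ₂ => ?_
      · simp only [smpAddr, Expr.Bdd, Expr.eval, BinOp.eval, e3]; omega
      · simp only [Expr.Bdd, Function.update_self]; omega
      simp only [smpAddr, Expr.eval, BinOp.eval, e3, Function.update_self]
      simp only [smpAddr, Expr.nodes] at hτ₂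
      refine (hg _ _ _ ⟨fun x hx hx' hx2 => by simp [hx2, h6 x hx hx' hx2], by simp [h7],
        fun a ha => ?_, fun i hi => ?_⟩ e3 (by omega)).trans ?_
      · rw [Function.update_of_ne (by omega), h8 a ha]
      · rcases Nat.lt_succ_iff_lt_or_eq.1 hi with hi | rfl
        · rw [Function.update_of_ne (by omega)]; exact h9 i hi
        · simpa using hc
      · simp only [hΦ]
        refine le_of_eq ?_
        congr 1
        refine Finset.sum_congr rfl fun x _ => ?_
        rw [Finset.prod_range_succ, Function.update_self, Finset.prod_congr rfl
          (g := fun i => g x i (m (4 * i + 2)))]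
        · ring
        · intro i hi
          rw [Finset.mem_range] at hi
          rw [Function.update_of_ne (by omega)]
    refine (Finset.sum_le_sum step).trans ?_
    rw [Finset.sum_add_distrib, Finset.sum_const, Finset.card_range, nsmul_eq_mul,
      Finset.sum_comm, hΦ]
    simp only [mul_add, ← Finset.mul_sum]
    gcongr
    rw [Finset.mul_sum]
    refine Finset.sum_le_sum fun x hx => ?_
    rw [Finset.prod_eq_prod_Ico_succ_bot hj]
    calc _ ≤ w x * ((∏ i ∈ Finset.range j, g x i (m (4 * i + 2))) *
          ∏ i ∈ Finset.Ico (j + 1) k, q x i) * (n * q x j) := by gcongr; exact hq x hx j hj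
      _ = _ := by ring
  · refine ⟨fun x _ hx _ => by simp [hx], by simp, fun _ _ => rfl, by simp⟩
  · rintro r m τ' ⟨h1, h2, h3, h4⟩ hτ'
    refine (post r m τ' h1 h2 h3 h4 ?_).trans (by simp [hΦ])
    simp only [Expr.nodes, Finset.sum_const, Finset.card_range, smul_eq_mul] at hτ'
    have : (V.size + 1) * (40 * (k + 1)) = (V.size + 1) * 8 +
      k * ((V.size + 1) * 20) + (V.size + 1) * (1 + 8) * (k + 1) +
      (V.size + 1) * (11 * k + 23) := by ring
    omega

/-- The table entries of node `v` that are not empty hold neighbours of `v` with the right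
centre. -/
def RowOK (G : SimpleGraph (Fin n)) (m : ℕ → ℕ) (v : ℕ) : Prop :=
  ∀ a ≤ n, m (tblIdx v a) = 0 ∨
    (a ≠ 0 ∧ ∃ w < n, adjQuery G v w = 1 ∧ m (tblIdx v a) = w + 1 ∧ m (4 * w + 1) = a)

theorem RowOK.congr {m m' : ℕ → ℕ} {v : ℕ} (h : RowOK G m v)
    (h1 : ∀ a ≤ n, m' (tblIdx v a) = m (tblIdx v a)) (h2 : ∀ w < n, m' (4 * w + 1) = m (4 * w + 1)) :
    RowOK G m' v := by
  intro a ha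
  rw [h1 a ha]
  rcases h a ha with h | ⟨h3, w, hw, h4, h5, h6⟩
  · exact .inl h
  · exact .inr ⟨h3, w, hw, h4, h5, by rw [h2 w hw, h6]⟩

theorem tblIdx_le {v a : ℕ} (hv : v < n) (ha : a ≤ n) : (v + a) * (v + a) ≤ 4 * (n * n) := by
  have : v + a ≤ 2 * n := by omega
  nlinarith

/-- `X` collects the clusters that should be found and `q` bounds the chance that one draw misses a
given one of them; `R` draws miss it with probability at most `q ^ R`. The extra term in `post`
counts the clusters of `X` that stayed unfound. -/
theorem wp_probeRowCmd_le {R v : ℕ} (hn : 0 < n) (hRF : R < F)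
    (hV : 16 * (n * n) + 8 * n + 8 ≤ V) (hRV : R < V)
    (h3 : s.reg 3 = v) (hv : v < n) (h5 : s.reg 5 = R) (hd : 0 < L.degQuery v)
    (hC : ∀ u < n, s.mem (4 * u + 1) ≤ n) (hrow : RowOK G s.mem v)
    (X : Finset ℕ) (q : ℝ≥0∞)
    (hX : ∀ a ∈ X, a ≠ 0 ∧ a ≤ n ∧ ((({i ∈ Finset.range (L.degQuery v) |
      s.mem (4 * L.nbrQuery v i + 1) ≠ a} : Finset ℕ).card : ℝ≥0∞)) ≤ q * L.degQuery v)
    (post : ∀ r m τ, (∀ x < 6, r x = s.reg x) →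
      (∀ a, (∀ a' ≤ n, a ≠ tblIdx v a') → m a = s.mem a) → RowOK G m v →
      τ ≤ s.time + (V.size + 1) * (60 * (R + 1)) →
      f ⟨r, m, τ⟩ ≤ b + ∑ a ∈ X, if m (tblIdx v a) = 0 then 1 else 0) :
    wp L F probeRowCmd f s ≤ b + X.card * q ^ R := by
  unfold probeRowCmd
  -- Every cluster of `X` still missing after `j` draws is weighted by its chance to survive the
  -- remaining `R - j` draws.
  set Φ : ℕ → (ℕ → ℕ) → ℝ≥0∞ := fun j m => b + ∑ a ∈ X,
    (if m (tblIdx v a) = 0 then 1 else 0) * q ^ (R - j) with hΦ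
  have hΦ0 : Φ 0 s.mem ≤ b + X.card * q ^ R := by
    simp only [hΦ, Nat.sub_zero, ← Finset.sum_mul]
    gcongr
    rw [Finset.card_eq_sum_ones, Nat.cast_sum]
    refine Finset.sum_le_sum fun a _ => ?_
    split_ifs <;> simp
  refine le_trans ?_ hΦ0
  refine wp_forUp_le V R (fun j r m => (∀ x < 6, r x = s.reg x) ∧
    (∀ a, (∀ a' ≤ n, a ≠ tblIdx v a') → m a = s.mem a) ∧ RowOK G m v) Φ
    (fun j => (V.size + 1) * 50) hRF hRV ?_ ?_ ?_ ?_ ?_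
  · rintro j r m x ⟨h1, h2⟩
    by_cases hx : x = 7
    · exact ⟨fun y hy => by rw [Function.update_of_ne (by omega), h1 y hy], h2⟩
    · exact ⟨fun y hy => by rw [Function.update_of_ne (by omega), h1 y hy], h2⟩
  · rintro j hj r m τ ⟨h1, -⟩
    simp only [Expr.Bdd, Expr.eval, h1 5 (by simp), h5, and_true]; omega
  · rintro j hj r m τ₀ ⟨h1, h2, h4⟩ hj7 g hg
    have hr3 : r 3 = v := by rw [h1 3 (by simp), h3]
    have hCm : ∀ u, m (4 * u + 1) = s.mem (4 * u + 1) := fun u =>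
      h2 _ fun a' _ h => by have := tblIdx_mod v a'; omega
    have hdn := L.degQuery_le v
    rw [wp_seq]
    refine wp_rand_le V ?_ ?_ fun τ₁ hτ₁ => ?_
    · simp only [Expr.Bdd, Expr.eval, hr3]; omega
    · simp only [Expr.eval, hr3]; omega
    simp only [Expr.eval, hr3]
    simp only [Expr.nodes] at hτ₁
    have step : ∀ i ∈ Finset.range (L.degQuery v),
        wp L F (.seq (.assign 8 (.nbr (.reg 3) (.reg 6))) (.seq (.assign 9 (.mem (ctrAddr (.reg 8))))
          (.cond (.reg 9) (.store (tblAddr (.reg 3) (.reg 9)) (.op .add (.reg 8) (.lit 1))) .skip)))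
          g ⟨Function.update r 6 i, m, τ₁⟩ ≤
        b + ∑ a ∈ X, ((if m (tblIdx v a) = 0 then 1 else 0) * q ^ (R - (j + 1))) *
          (if s.mem (4 * L.nbrQuery v i + 1) ≠ a then 1 else 0) := by
      intro i hi
      rw [Finset.mem_range] at hi
      have hu := L.nbrQuery_lt hn v i
      have hA := L.adjQuery_nbrQuery hi
      have hCu := hC _ hu
      set u := L.nbrQuery v i with hudef
      set c := s.mem (4 * u + 1) with hcdef
      have e3 : Function.update r 6 i 3 = v := by simp [hr3]
      rw [wp_seq]
      refine wp_assign_le V ?_ fun τ₂ hτ₂ => ?_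
      · simp only [Expr.Bdd, Expr.eval, e3, Function.update_self, ← hudef]; omega
      simp only [Expr.eval, e3, Function.update_self, ← hudef]
      simp only [Expr.nodes] at hτ₂
      rw [wp_seq]
      refine wp_assign_le V ?_ fun τ₃ hτ₃ => ?_
      · simp only [ctrAddr, Expr.Bdd, Expr.eval, BinOp.eval, Function.update_self, hCm, ← hcdef]
        omega
      simp only [ctrAddr, Expr.eval, BinOp.eval, Function.update_self, hCm, ← hcdef]
      simp only [ctrAddr, Expr.nodes] at hτ₃
      set r' := Function.update (Function.update (Function.update r 6 i) 8 u) 9 c with hr'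
      have e6 : ∀ x < 6, r' x = s.reg x := by
        intro x hx
        rw [hr', Function.update_of_ne (by omega), Function.update_of_ne (by omega),
          Function.update_of_ne (by omega), h1 x hx]
      have e3 : r' 3 = v := by rw [e6 3 (by simp), h3]
      have e7 : r' 7 = j := by simp [hr', hj7]
      have e8 : r' 8 = u := by simp [hr']
      have e9 : r' 9 = c := by simp [hr']
      refine wp_cond_le V ?_ (fun h τ₄ hτ₄ => ?_) (fun h τ₄ hτ₄ => ?_)
      · simp only [Expr.Bdd, e9]; omega
      · simp only [Expr.eval, e9] at h
        simp only [Expr.nodes] at hτ₄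
        refine wp_store_le V ?_ ?_ fun τ₅ hτ₅ => ?_
        · have := tblIdx_le hv hCu
          have : v + c ≤ V := by omega
          simp only [tblAddr, Expr.Bdd, Expr.eval, BinOp.eval, e3, e9]
          omega
        · simp only [Expr.Bdd, Expr.eval, BinOp.eval, e8]; omega
        simp only [tblAddr, Expr.eval, BinOp.eval, e3, e8, e9]
        simp only [tblAddr, Expr.nodes] at hτ₅
        change g ⟨r', Function.update m (tblIdx v c) (u + 1), τ₅⟩ ≤ _
        refine (hg _ _ _ ⟨e6, fun a ha => ?_, ?_⟩ e7 (by omega)).trans ?_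
        · rw [Function.update_of_ne (ha c hCu), h2 a ha]
        · intro a ha
          have hne : ∀ w, Function.update m (tblIdx v c) (u + 1) (4 * w + 1) = m (4 * w + 1) := by
            intro w
            rw [Function.update_of_ne]
            have := tblIdx_mod v c
            omega
          by_cases hac : a = c
          · right
            refine ⟨hac ▸ h, u, hu, hA, by simp [hac], by rw [hne, hCm, hac]⟩
          · rw [Function.update_of_ne (by simp [tblIdx_inj, hac])]
            simp only [hne]
            exact h4 a ha
        · simp only [hΦ]
          refine add_le_add le_rfl (Finset.sum_le_sum fun a ha => ?_)
          by_cases hac : c = a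
          · simp [hac]
          · rw [Function.update_of_ne (by simp [tblIdx_inj, Ne.symm hac])]
            simp [hac]
      · simp only [Expr.eval, e9] at h
        simp only [Expr.nodes] at hτ₄
        refine wp_skip_le ((hg _ _ _ ⟨e6, h2, h4⟩ e7 (by simp only; omega)).trans ?_)
        simp only [hΦ]
        refine add_le_add le_rfl (Finset.sum_le_sum fun a ha => ?_)
        -- A drawn neighbour without a centre has code `0`, which is not in `X`, so it counts as a
        -- miss for every cluster.
        have : c ≠ a := by rw [h]; exact (hX a ha).1.symm
        simp [this]
    refine (Finset.sum_le_sum step).trans ?_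
    rw [Finset.sum_add_distrib, Finset.sum_const, Finset.card_range, nsmul_eq_mul,
      Finset.sum_comm, hΦ]
    simp only [mul_add, ← Finset.mul_sum]
    gcongr
    rw [Finset.mul_sum]
    refine Finset.sum_le_sum fun a ha => ?_
    have e : R - j = R - (j + 1) + 1 := by omega
    rw [e, pow_succ, Finset.sum_boole]
    calc _ ≤ ((if m (tblIdx v a) = 0 then 1 else 0) * q ^ (R - (j + 1))) *
          (q * L.degQuery v) := by gcongr; exact (hX a ha).2.2
      _ = _ := by ring
  · exact ⟨fun _ _ => rfl, fun _ _ => rfl, hrow⟩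
  · rintro r m τ' ⟨h1, h2, h4⟩ hτ'
    refine (post r m τ' h1 h2 h4 (hτ'.trans ?_)).trans (by simp [hΦ])
    simp only [Expr.nodes, Finset.sum_const, Finset.card_range, smul_eq_mul]
    nlinarith [Nat.zero_le (V.size * R)]

/-- The rows of different nodes occupy disjoint table cells, so finished rows keep their count of
unfound clusters while the rows to come are charged their expected count. -/
theorem wp_probeCmd_le {R : ℕ} (hn : 0 < n) (hF : n < F) (hRF : R < F)
    (hV : 16 * (n * n) + 8 * n + 8 ≤ V) (hRV : R < V) (h1V : s.reg 1 ≤ V) (h2V : s.reg 2 ≤ V)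
    (h0 : s.reg 0 = n) (hR : s.reg 2 * s.reg 1 = R)
    (hC : ∀ u < n, s.mem (4 * u + 1) ≤ n) (hT : ∀ v < n, ∀ a ≤ n, s.mem (tblIdx v a) = 0)
    (X : ℕ → Finset ℕ) (q : ℝ≥0∞)
    (hX : ∀ v < n, ∀ a ∈ X v, n ≤ L.degQuery v * L.degQuery v ∧ a ≠ 0 ∧ a ≤ n ∧
      ((({i ∈ Finset.range (L.degQuery v) | s.mem (4 * L.nbrQuery v i + 1) ≠ a} :
        Finset ℕ).card : ℝ≥0∞)) ≤ q * L.degQuery v)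
    (post : ∀ r m τ, (∀ a, (∀ v < n, ∀ a' ≤ n, a ≠ tblIdx v a') → m a = s.mem a) →
      (∀ v < n, RowOK G m v) →
      (∀ v < n, L.degQuery v * L.degQuery v < n → ∀ a ≤ n, m (tblIdx v a) = 0) →
      τ ≤ s.time + (V.size + 1) * (100 * (n * (R + 1))) →
      f ⟨r, m, τ⟩ ≤ b + ∑ v ∈ Finset.range n, ∑ a ∈ X v, if m (tblIdx v a) = 0 then 1 else 0) :
    wp L F probeCmd f s ≤ b + ∑ v ∈ Finset.range n, (X v).card * q ^ R := by
  unfold probeCmd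
  rw [wp_seq]
  refine wp_assign_le V ?_ fun τ hτ => ?_
  · simp only [Expr.Bdd, Expr.eval, BinOp.eval, hR]; omega
  simp only [Expr.eval, BinOp.eval, hR]
  simp only [Expr.nodes] at hτ
  set Φ : ℕ → (ℕ → ℕ) → ℝ≥0∞ := fun j m => b +
    (∑ v ∈ Finset.range j, ∑ a ∈ X v, if m (tblIdx v a) = 0 then 1 else 0) +
    ∑ v ∈ Finset.Ico j n, (X v).card * q ^ R with hΦ
  have hΦ0 : b + ∑ v ∈ Finset.range n, (X v).card * q ^ R = Φ 0 s.mem := by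
    simp [hΦ]
  rw [hΦ0]
  refine wp_forUp_le V n (fun j r m => r 0 = n ∧ r 5 = R ∧
    (∀ a, (∀ v < j, ∀ a' ≤ n, a ≠ tblIdx v a') → m a = s.mem a) ∧ (∀ v < j, RowOK G m v) ∧
    (∀ v < j, L.degQuery v * L.degQuery v < n → ∀ a ≤ n, m (tblIdx v a) = 0)) Φ
    (fun j => (V.size + 1) * (60 * (R + 1) + 9)) hF (by omega) ?_ ?_ ?_ ?_ ?_
  · rintro j r m x ⟨h1, h2, h3⟩
    exact ⟨by simpa using h1, by simpa using h2, h3⟩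
  · rintro j hj r m τ ⟨h1, -⟩
    simp only [Expr.Bdd, Expr.eval, h1, and_true]; omega
  · rintro j hj r m τ₀ ⟨h1, h2, h3, h4, h5⟩ hj3 g hg
    have hd := L.degQuery_le j
    have hdd : L.degQuery j * L.degQuery j ≤ n * n := Nat.mul_le_mul hd hd
    have hCm : ∀ u, m (4 * u + 1) = s.mem (4 * u + 1) := fun u =>
      h3 _ fun v _ a' _ h => by have := tblIdx_mod v a'; omega
    have hrow : ∀ v, j ≤ v → v < n → ∀ a ≤ n, m (tblIdx v a) = 0 := by
      intro v hv hvn a ha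
      rw [h3 _ fun v' hv' a' _ h => by rw [tblIdx_inj] at h; omega, hT v hvn a ha]
    refine wp_cond_le V ?_ (fun h τ₂ hτ₂ => ?_) (fun h τ₂ hτ₂ => ?_)
    · simp only [Expr.Bdd, Expr.eval, BinOp.eval, hj3, h1]
      refine ⟨⟨?_, ?_, ?_⟩, ?_, ?_⟩ <;> try split_ifs
      all_goals omega
    · simp only [Expr.eval, BinOp.eval, hj3, h1, ne_eq, ite_eq_right_iff, one_ne_zero, imp_false,
        not_not] at h
      simp only [Expr.nodes] at hτ₂
      have hXj : X j = ∅ := Finset.eq_empty_of_forall_notMem fun a ha => by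
        have := (hX j hj a ha).1; omega
      refine wp_skip_le ((hg _ _ _ ⟨h1, h2, fun a ha => h3 a fun v hv => ha v (by omega), ?_, ?_⟩
        hj3 ?_).trans ?_)
      · intro v hv
        rcases Nat.lt_succ_iff_lt_or_eq.1 hv with hv | rfl
        · exact h4 v hv
        · exact fun a ha => .inl (hrow v le_rfl hj a ha)
      · intro v hv hlow a ha
        rcases Nat.lt_succ_iff_lt_or_eq.1 hv with hv | rfl
        · exact h5 v hv hlow a ha
        · exact hrow v le_rfl hj a ha
      · simp only
        have : (V.size + 1) * (60 * (R + 1) + 9) = (V.size + 1) * (60 * (R + 1)) +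
          (V.size + 1) * 9 := by ring
        omega
      · simp only [hΦ]
        rw [Finset.sum_range_succ, Finset.sum_eq_sum_Ico_succ_bot hj, hXj]
        simp
    · simp only [Expr.eval, BinOp.eval, hj3, h1, ite_eq_right_iff, one_ne_zero, imp_false,
        not_lt] at h
      simp only [Expr.nodes] at hτ₂
      have hpos : 0 < L.degQuery j := by
        by_contra h'
        have : L.degQuery j = 0 := by omega
        rw [this] at h; omega
      refine (wp_probeRowCmd_le (b := b +
        (∑ v ∈ Finset.range j, ∑ a ∈ X v, if m (tblIdx v a) = 0 then 1 else 0) +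
        ∑ v ∈ Finset.Ico (j + 1) n, (X v).card * q ^ R) (v := j)
        hn hRF hV hRV hj3 hj h2 hpos (fun u hu => by simpa [hCm] using hC u hu)
        (fun a ha => .inl (hrow j le_rfl hj a ha)) (X j) q
        (fun a ha => ⟨(hX j hj a ha).2.1, (hX j hj a ha).2.2.1, by
          simpa [hCm] using (hX j hj a ha).2.2.2⟩) ?_).trans ?_
      · intro r' m' τ' h6 h7 h8 h9
        simp only at h6 h7 h9
        have hm' : ∀ v ≠ j, ∀ a, m' (tblIdx v a) = m (tblIdx v a) := by
          intro v hv a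
          exact h7 _ fun a' _ h => by rw [tblIdx_inj] at h; omega
        have hCm' : ∀ u, m' (4 * u + 1) = m (4 * u + 1) := fun u =>
          h7 _ fun a' _ h => by have := tblIdx_mod j a'; omega
        refine (hg _ _ _ ⟨by rw [h6 0 (by simp), h1], by rw [h6 5 (by simp), h2],
          fun a ha => ?_, fun v hv => ?_, fun v hv hlow a ha => ?_⟩ (by rw [h6 3 (by simp), hj3])
          ?_).trans ?_
        · rw [h7 a (ha j (by omega)), h3 a fun v hv => ha v (by omega)]
        · rcases Nat.lt_succ_iff_lt_or_eq.1 hv with hv | rfl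
          · exact (h4 v hv).congr (fun a _ => hm' v hv.ne a) fun w _ => hCm' w
          · exact h8
        · rcases Nat.lt_succ_iff_lt_or_eq.1 hv with hv | rfl
          · rw [hm' v hv.ne]; exact h5 v hv hlow a ha
          · omega
        · have : (V.size + 1) * (60 * (R + 1) + 9) = (V.size + 1) * (60 * (R + 1)) +
            (V.size + 1) * 9 := by ring
          omega
        · simp only [hΦ]
          rw [Finset.sum_range_succ]
          have e : ∑ v ∈ Finset.range j, ∑ a ∈ X v, (if m' (tblIdx v a) = 0 then (1 : ℝ≥0∞) else 0) =
              ∑ v ∈ Finset.range j, ∑ a ∈ X v, if m (tblIdx v a) = 0 then 1 else 0 := by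
            refine Finset.sum_congr rfl fun v hv => Finset.sum_congr rfl fun a _ => ?_
            rw [Finset.mem_range] at hv
            rw [hm' v hv.ne]
          rw [e]
          exact le_of_eq (by ring)
      · simp only [hΦ]
        rw [Finset.sum_eq_sum_Ico_succ_bot hj]
        exact le_of_eq (by ring)
  · refine ⟨by simp [h0], by simp, fun _ _ => rfl, by simp, by simp⟩
  · rintro r m τ' ⟨h1, h2, h3, h4, h5⟩ hτ'
    refine (post r m τ' h3 h4 h5 (hτ'.trans ?_)).trans (by simp [hΦ])
    simp only [Expr.nodes, Finset.sum_const, Finset.card_range, smul_eq_mul]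
    have : (V.size + 1) * (100 * (n * (R + 1))) = n * ((V.size + 1) * (60 * (R + 1) + 9)) +
      (V.size + 1) * (n * (40 * R + 31)) := by ring
    have h6 : 1 ≤ n := hn
    have : (V.size + 1) * (4 + (1 + 8) * (n + 1)) ≤ (V.size + 1) * (n * (40 * R + 31)) := by
      gcongr
      nlinarith
    have : (V.size + 1) * (4 + (1 + 8) * (n + 1)) = (V.size + 1) * (1 + 1 + 1 + 1) +
      (V.size + 1) * (1 + 8) * (n + 1) := by ring
    omega

end Phases

/-! ## The spanner described by the memory -/

/-- The memory makes node `v` keep its edge to node `u`. -/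
def Marks (m : ℕ → ℕ) (v u : ℕ) : Prop :=
  m (4 * v + 1) = u + 1 ∨ m (tblIdx v (m (4 * u + 1))) = u + 1 ∨
    (m (4 * v) ≤ m (4 * u) ∧ m (tblIdx v (m (4 * u + 1))) = 0)

/-- The subgraph of all edges kept by one of their ends. -/
def keptGraph {n : ℕ} (G : SimpleGraph (Fin n)) (m : ℕ → ℕ) : SimpleGraph (Fin n) where
  Adj u v := G.Adj u v ∧ (Marks m u v ∨ Marks m v u)
  symm := ⟨fun _ _ h => ⟨h.1.symm, h.2.symm⟩⟩
  loopless := ⟨fun _ h => h.1.ne rfl⟩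

/-- The expression for `Marks`. -/
def marksExpr (v u : Expr) : Expr :=
  .op .add (.op .eq (.mem (ctrAddr v)) (.op .add u (.lit 1)))
    (.op .add (.op .eq (.mem (tblAddr v (.mem (ctrAddr u)))) (.op .add u (.lit 1)))
      (.op .mul (.op .lt (.mem (degAddr v)) (.op .add (.mem (degAddr u)) (.lit 1)))
        (.op .eq (.mem (tblAddr v (.mem (ctrAddr u)))) (.lit 0))))

/-- The query program. -/
def queryCmd : Cmd :=
  .assign 0 (.op .mul (.adj (.reg 0) (.reg 1))
    (.op .lt (.lit 0) (.op .add (marksExpr (.reg 0) (.reg 1)) (marksExpr (.reg 1) (.reg 0)))))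

section Oracle

variable {n : ℕ} {G : SimpleGraph (Fin n)} {L : AdjacencyList G} {V : ℕ}

/-- Sums of 0/1 tests act as disjunctions and products as conjunctions; `≤` is tested as `<` after
adding one. -/
theorem eval_marksExpr {s : MachineState} {x y : ℕ} :
    0 < (marksExpr (.reg x) (.reg y)).eval L s ↔ Marks s.mem (s.reg x) (s.reg y) := by
  have e : (marksExpr (.reg x) (.reg y)).eval L s =
      (if s.mem (4 * s.reg x + 1) = s.reg y + 1 then 1 else 0) +
      ((if s.mem (tblIdx (s.reg x) (s.mem (4 * s.reg y + 1))) = s.reg y + 1 then 1 else 0) +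
      (if s.mem (4 * s.reg x) < s.mem (4 * s.reg y) + 1 then 1 else 0) *
      (if s.mem (tblIdx (s.reg x) (s.mem (4 * s.reg y + 1))) = 0 then 1 else 0)) := rfl
  rw [e, Marks]
  simp only [Nat.lt_succ_iff]
  split_ifs <;> simp_all

theorem marksExpr_bdd {s : MachineState} {x y : ℕ} (hV : 16 * (n * n) + 8 * n + 8 ≤ V)
    (hx : s.reg x < n) (hy : s.reg y < n) (hd : ∀ v < n, s.mem (4 * v) ≤ n)
    (hC : ∀ v < n, s.mem (4 * v + 1) ≤ n) (hT : ∀ v < n, ∀ a ≤ n, s.mem (tblIdx v a) ≤ n) :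
    (marksExpr (.reg x) (.reg y)).Bdd L V s ∧ (marksExpr (.reg x) (.reg y)).eval L s ≤ 3 := by
  set v := s.reg x with hv
  set u := s.reg y with hu
  have h1 := hd v hx
  have h2 := hd u hy
  have h3 := hC v hx
  have h4 := hC u hy
  have h5 := hT v hx _ h4
  have h6 := tblIdx_le hx h4
  have h7 : v + s.mem (4 * u + 1) ≤ V := by omega
  have e1 : ∀ (p q r t : Prop) [Decidable p] [Decidable q] [Decidable r] [Decidable t],
      (if r then 1 else 0) * (if t then 1 else 0) ≤ 1 ∧
      (if q then 1 else 0) + (if r then 1 else 0) * (if t then 1 else 0) ≤ 2 ∧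
      (if p then 1 else 0) + ((if q then 1 else 0) + (if r then 1 else 0) * (if t then 1 else 0))
        ≤ 3 := by
    intro p q r t _ _ _ _; split_ifs <;> simp
  have e2 : ∀ (p : Prop) [Decidable p], (if p then 1 else 0) ≤ V := by
    intro p _; split_ifs <;> omega
  have h8 : 3 ≤ V := by omega
  simp only [marksExpr, ctrAddr, tblAddr, degAddr, Expr.Bdd, Expr.eval, BinOp.eval, ← hv, ← hu]
  simp only [tblIdx] at h5
  refine ⟨?_, (e1 _ _ _ _).2.2⟩
  simp only [e2, ((e1 True True _ _).1.trans (show 1 ≤ V by omega)),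
    ((e1 True _ _ _).2.1.trans (show 2 ≤ V by omega)), ((e1 _ _ _ _).2.2.trans h8), and_true]
  omega

theorem marksExpr_nodes (x y : ℕ) : (marksExpr (.reg x) (.reg y)).nodes = 88 := by rfl

/-- What the preprocessing program guarantees about the memory in any case. -/
structure MemoryOK (L : AdjacencyList G) (k : ℕ) (m : ℕ → ℕ) : Prop where
  deg : ∀ v < n, m (4 * v) = L.degQuery v
  smp : ∀ j < k, m (4 * j + 2) < n
  ctr : CentersAssigned G k m
  row : ∀ v < n, RowOK G m v
  low : ∀ v < n, L.degQuery v * L.degQuery v < n → ∀ a ≤ n, m (tblIdx v a) = 0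

variable {k : ℕ} {m : ℕ → ℕ}

theorem CentersAssigned.le (h : CentersAssigned G k m) (hs : ∀ j < k, m (4 * j + 2) < n) :
    ∀ u < n, m (4 * u + 1) ≤ n := by
  intro u hu
  rcases h u hu with ⟨h, -⟩ | ⟨i, hi, h, -⟩
  · omega
  · have := hs i hi
    omega

theorem RowOK.le {v : ℕ} (h : RowOK G m v) : ∀ a ≤ n, m (tblIdx v a) ≤ n := by
  intro a ha
  rcases h a ha with h | ⟨-, w, hw, -, h, -⟩ <;> omega

/-- The query is one loop-free assignment of fixed syntactic size, so its cost is a constant times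
the bit length of the largest number involved. -/
theorem queryCmd_isAdjacencyOracle (hm : MemoryOK L k m) (hV : 16 * (n * n) + 8 * n + 8 ≤ V) :
    IsAdjacencyOracle L queryCmd m (keptGraph G m) ((V.size + 1) * 200) := by
  refine ⟨by simp [queryCmd, Cmd.IsQuery, Expr.OnlyAdj, marksExpr, ctrAddr, tblAddr, degAddr],
    fun u v => ⟨0, _, rfl, ?_, ?_⟩⟩
  · set s := startState m u v with hs
    have h0 : s.reg 0 = u := rfl
    have h1 : s.reg 1 = v := rfl
    have hd : ∀ v < n, s.mem (4 * v) ≤ n := fun v hv => by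
      change m _ ≤ n
      rw [hm.deg v hv]; exact L.degQuery_le v
    have hC := hm.ctr.le hm.smp
    have hT : ∀ v < n, ∀ a ≤ n, s.mem (tblIdx v a) ≤ n := fun v hv => (hm.row v hv).le
    have hu : s.reg 0 < n := u.2
    have hv : s.reg 1 < n := v.2
    obtain ⟨b1, c1⟩ := marksExpr_bdd (L := L) hV hu hv hd hC hT
    obtain ⟨b2, c2⟩ := marksExpr_bdd (L := L) hV hv hu hd hC hT
    have ha := adjQuery_le_one G (s.reg 0) (s.reg 1)
    have hB : (Expr.op .mul (.adj (.reg 0) (.reg 1)) (.op .lt (.lit 0)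
        (.op .add (marksExpr (.reg 0) (.reg 1)) (marksExpr (.reg 1) (.reg 0))))).Bdd L V s := by
      have e : ∀ (p : Prop) [Decidable p], (if p then 1 else 0) ≤ 1 := by
        intro p _; split_ifs <;> simp
      refine ⟨⟨?_, ?_, ?_⟩, ⟨?_, ⟨b1, b2, ?_⟩, ?_⟩, ?_⟩
      · simp only [Expr.Bdd]; omega
      · simp only [Expr.Bdd]; omega
      · simp only [Expr.eval]; omega
      · exact Nat.zero_le _
      · simp only [BinOp.eval]; omega
      · exact (e _).trans (by omega)
      · exact (Nat.mul_le_mul ha (e _)).trans (by omega)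
    have := hB.cost_le
    simp only [Expr.nodes, marksExpr_nodes] at this
    have h3 : s.time + (1 + Expr.cost L s (Expr.op .mul (.adj (.reg 0) (.reg 1)) (.op .lt (.lit 0)
        (.op .add (marksExpr (.reg 0) (.reg 1)) (marksExpr (.reg 1) (.reg 0)))))) ≤
        (V.size + 1) * 200 := by
      have : s.time = 0 := rfl
      omega
    exact_mod_cast h3
  · set s := startState m u v with hs
    have h0 : s.reg 0 = u := rfl
    have h1 : s.reg 1 = v := rfl
    have hM1 := eval_marksExpr (L := L) (s := s) (x := 0) (y := 1)
    have hM2 := eval_marksExpr (L := L) (s := s) (x := 1) (y := 0)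
    rw [h0, h1] at hM1 hM2
    have hsm : s.mem = m := rfl
    rw [hsm] at hM1 hM2
    simp only [Function.update_self, Expr.eval, BinOp.eval, h0, h1]
    have e : (keptGraph G m).Adj u v ↔ adjQuery G u v = 1 ∧
        0 < (marksExpr (.reg 0) (.reg 1)).eval L s + (marksExpr (.reg 1) (.reg 0)).eval L s := by
      rw [Nat.add_pos_iff_pos_or_pos, hM1, hM2, adjQuery_fin]; rfl
    have ha := adjQuery_le_one G u v
    rw [e]
    split_ifs with h
    · simp only [h, and_true, if_true, mul_one]; omega
    · right; simp [h]

/-! ## Stretch -/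

/-- Replace each edge of a shortest path by a detour of length at most `k`. Positivity of `k` is
needed for unreachable pairs, where `k * ⊤` must be `⊤`. -/
theorem isSpanner_of_edist_le {V : Type*} {G H : SimpleGraph V} {k : ℕ} (hk0 : 0 < k) (h : H ≤ G)
    (hk : ∀ s t, G.Adj s t → H.edist s t ≤ k) : IsSpanner k G H := by
  refine ⟨h, fun s t => ?_⟩
  have key : ∀ {s t : V} (p : G.Walk s t), H.edist s t ≤ (k : ℕ∞) * (p.length : ℕ∞) := by
    intro s t p
    induction p with
    | nil => simp
    | cons hA p ih =>
      refine (SimpleGraph.edist_triangle).trans ((add_le_add (hk _ _ hA) ih).trans ?_)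
      rw [SimpleGraph.Walk.length_cons]
      push_cast
      rw [mul_add, mul_one, add_comm]
  by_cases hr : G.Reachable s t
  · obtain ⟨p, hp⟩ := hr.exists_walk_length_eq_edist
    rw [← hp]; exact key p
  · rw [SimpleGraph.edist_eq_top_of_not_reachable hr]
    rw [ENat.mul_top (by simpa using hk0.ne')]
    exact le_top

/-- An edge not kept by its end `v` of smaller degree has a nonempty table entry, for otherwise the
third clause of `Marks` would keep it. The remembered `w` shares the centre `c` of `u`, and all
three edges of the path `v, w, c, u` are kept: the first by the table clause, the others because
nodes keep the edge to their centre. -/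
theorem isSpanner_keptGraph (hm : MemoryOK L k m) : IsSpanner 3 G (keptGraph G m) := by
  have hle : keptGraph G m ≤ G := fun u v h => h.1
  have h1 : ∀ {u v : Fin n}, (keptGraph G m).Adj u v → (keptGraph G m).edist u v ≤ 1 :=
    fun h => (SimpleGraph.edist_eq_one_iff_adj.2 h).le
  have hctr : ∀ u : Fin n, m (4 * u + 1) ≠ 0 →
      ∃ c : Fin n, m (4 * u + 1) = c + 1 ∧ (keptGraph G m).Adj u c := by
    intro u hu
    rcases hm.ctr u u.2 with ⟨h, -⟩ | ⟨i, hi, h, hA, -⟩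
    · exact absurd h hu
    · refine ⟨⟨m (4 * i + 2), hm.smp i hi⟩, h, ?_, .inl (.inl h)⟩
      exact ((adjQuery_fin G ⟨m (4 * i + 2), hm.smp i hi⟩ u).1 hA).symm
  have key : ∀ u v : Fin n, G.Adj v u → L.degQuery v ≤ L.degQuery u →
      (keptGraph G m).edist v u ≤ 3 := by
    intro u v hA hd
    by_cases hM : Marks m v u
    · exact (h1 (u := v) (v := u) ⟨hA, .inl hM⟩).trans (by norm_num)
    unfold Marks at hM
    push Not at hM
    rw [hm.deg v v.2, hm.deg u u.2] at hM
    have hT := hM.2.2 hd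
    rcases hm.row v v.2 _ (hm.ctr.le hm.smp u u.2) with h | ⟨h0, w, hw, hvw, hTw, hCw⟩
    · exact absurd h hT
    obtain ⟨c, hc, huc⟩ := hctr u h0
    obtain ⟨c', hc', hwc⟩ := hctr ⟨w, hw⟩ (by simpa [hCw] using h0)
    have : c' = c := Fin.ext (by simp only [hCw, hc] at hc'; omega)
    subst this
    have hvw' : (keptGraph G m).Adj v ⟨w, hw⟩ :=
      ⟨(adjQuery_fin G v ⟨w, hw⟩).1 hvw, .inl (.inr (.inl (by simpa [hCw] using hTw)))⟩
    calc (keptGraph G m).edist v u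
        ≤ (keptGraph G m).edist v ⟨w, hw⟩ + ((keptGraph G m).edist ⟨w, hw⟩ c' +
          (keptGraph G m).edist c' u) :=
          SimpleGraph.edist_triangle.trans (add_le_add le_rfl SimpleGraph.edist_triangle)
      _ ≤ 1 + (1 + 1) := add_le_add (h1 hvw') (add_le_add (h1 hwc) (h1 huc.symm))
      _ = 3 := by norm_num
  refine isSpanner_of_edist_le (by norm_num) hle fun u v hA => ?_
  rcases le_total (L.degQuery u) (L.degQuery v) with h | h
  · exact key v u hA h
  · rw [SimpleGraph.edist_comm]; exact key u v hA.symm h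

/-! ## Number of edges -/

/-- Each edge is charged to an end that selects it; orienting edges this way bounds their number by
the sum of the out-degrees. -/
theorem ncard_edgeSet_le (H : SimpleGraph (Fin n)) (P : Fin n → Fin n → Prop) [DecidableRel P]
    (hP : ∀ u v, H.Adj u v → P u v ∨ P v u) :
    H.edgeSet.ncard ≤ ∑ v, ({u | P v u} : Finset (Fin n)).card := by
  have hsub : H.edgeSet ⊆ (((Finset.univ.filter fun p : Fin n × Fin n => P p.1 p.2).image
      fun p => s(p.1, p.2) : Finset (Sym2 (Fin n))) : Set (Sym2 (Fin n))) := by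
    intro e he
    induction e with
    | h u v =>
      simp only [Finset.coe_image, Finset.coe_filter, Finset.mem_univ, true_and, Set.mem_image,
        Set.mem_ofPred_eq, Prod.exists]
      rcases hP u v he with h | h
      · exact ⟨u, v, h, rfl⟩
      · exact ⟨v, u, h, Sym2.eq_swap⟩
  refine (Set.ncard_le_ncard hsub (Finset.finite_toSet _)).trans ?_
  rw [Set.ncard_coe_finset]
  refine Finset.card_image_le.trans (le_of_eq ?_)
  rw [← Finset.univ_product_univ, Finset.card_filter, Finset.sum_product]
  exact Finset.sum_congr rfl fun v _ => (Finset.card_filter _ _).symm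

theorem AdjacencyList.card_adj (L : AdjacencyList G) [DecidableRel G.Adj] (v : Fin n) :
    ({u | G.Adj v u} : Finset (Fin n)).card = L.degQuery v := by
  rw [L.degQuery_eq_degree, ← SimpleGraph.card_neighborFinset_eq_degree]
  congr 1
  ext; simp

/-- Every node of degree at least `√n` has a neighbour among its first few samples. -/
def SamplesHit (L : AdjacencyList G) (K : ℕ) (m : ℕ → ℕ) : Prop :=
  ∀ u < n, n ≤ L.degQuery u * L.degQuery u →
    ∃ i < K * (n / L.degQuery u + 1), adjQuery G (m (4 * i + 2)) u = 1

open Classical in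
/-- Every table entry of a centre that has many nodes adjacent to `v` is filled. -/
def ProbesHit (L : AdjacencyList G) (ρ : ℕ) (m : ℕ → ℕ) : Prop :=
  ∀ v : Fin n, n ≤ L.degQuery v * L.degQuery v → ∀ a ≤ n, a ≠ 0 →
    L.degQuery v ≤ ρ * ({u | G.Adj v u ∧ m (4 * u + 1) = a} : Finset (Fin n)).card →
    m (tblIdx v a) ≠ 0

open Classical in
-- Group the neighbours in question by cluster. There are at most `K (n/d + 1)` clusters, and each
-- holds at most `d/ρ` of these neighbours, since otherwise the probes would have filled the entry.
-- The product is at most `2 K n/ρ` because `d ≤ n`.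
theorem card_unhit_le {K ρ : ℕ} (hm : MemoryOK L k m)
    (h1 : SamplesHit L K m) (h2 : ProbesHit L ρ m)
    (hk : ∀ u < n, n ≤ L.degQuery u * L.degQuery u → K * (n / L.degQuery u + 1) ≤ k)
    (v : Fin n) (hv : n ≤ L.degQuery v * L.degQuery v) :
    ρ * ({u | G.Adj v u ∧ m (4 * v) ≤ m (4 * u) ∧ m (tblIdx v (m (4 * u + 1))) = 0} :
      Finset (Fin n)).card ≤ 2 * K * n := by
  set S : Finset (Fin n) := {u | G.Adj v u ∧ m (4 * v) ≤ m (4 * u) ∧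
    m (tblIdx v (m (4 * u + 1))) = 0} with hS
  set d := L.degQuery v with hd
  have hdpos : 0 < d := by
    by_contra h
    have : d = 0 := by omega
    rw [this] at hv
    have := v.2
    omega
  -- Only the codes of the first `K (n/d + 1)` samples can occur: a node `u` with `deg u ≥ d` is hit
  -- even earlier, and its centre is its first hit.
  set A : Finset ℕ := (Finset.range (K * (n / d + 1))).image fun i => m (4 * i + 2) + 1 with hA
  have hmap : ∀ u ∈ S, m (4 * (u : ℕ) + 1) ∈ A := by
    intro u hu
    simp only [hS, Finset.mem_filter, Finset.mem_univ, true_and] at hu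
    obtain ⟨huv, hdu, -⟩ := hu
    rw [hm.deg v v.2, hm.deg u u.2, ← hd] at hdu
    have hu2 : n ≤ L.degQuery u * L.degQuery u := hv.trans (Nat.mul_le_mul hdu hdu)
    obtain ⟨i, hi, hai⟩ := h1 u u.2 hu2
    have hmono : K * (n / L.degQuery u + 1) ≤ K * (n / d + 1) := by
      gcongr
    rcases hm.ctr u u.2 with ⟨-, h⟩ | ⟨j, hj, hc, -, hfirst⟩
    · exact absurd hai (h i (hi.trans_le (hk u u.2 hu2)))
    · rw [hA, Finset.mem_image]
      refine ⟨j, ?_, hc.symm⟩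
      rw [Finset.mem_range]
      by_contra hji
      exact hfirst i (by omega) hai
  have hcard : S.card = ∑ a ∈ A, (S.filter fun u : Fin n => m (4 * (u : ℕ) + 1) = a).card :=
    Finset.card_eq_sum_card_fiberwise hmap
  have hbound : ∀ a ∈ A, ρ * (S.filter fun u : Fin n => m (4 * (u : ℕ) + 1) = a).card ≤ d := by
    intro a _
    by_contra hcon
    push Not at hcon
    have hne : (S.filter fun u : Fin n => m (4 * (u : ℕ) + 1) = a).Nonempty := by
      rw [← Finset.card_pos]
      by_contra h
      have : (S.filter fun u : Fin n => m (4 * (u : ℕ) + 1) = a).card = 0 := by omega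
      rw [this] at hcon; omega
    obtain ⟨u, hu⟩ := hne
    have hu' := hu
    simp only [hS, Finset.mem_filter, Finset.mem_univ, true_and] at hu'
    obtain ⟨⟨-, -, hT⟩, hua⟩ := hu'
    have huA := hmap u (Finset.mem_filter.1 hu).1
    have ha0 : a ≠ 0 := by
      rw [hua, hA, Finset.mem_image] at huA
      obtain ⟨i, -, hi⟩ := huA
      omega
    have han : a ≤ n := by rw [← hua]; exact hm.ctr.le hm.smp u u.2
    refine h2 v hv a han ha0 ?_ (by rw [← hua]; exact hT)
    refine hcon.le.trans ?_
    gcongr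
    intro x hx
    simp only [hS, Finset.mem_filter, Finset.mem_univ, true_and] at hx ⊢
    exact ⟨hx.1.1, hx.2⟩
  have hAcard : A.card ≤ K * (n / d + 1) := Finset.card_image_le.trans (by simp)
  have hdn : d ≤ n := L.degQuery_le v
  calc ρ * S.card = ∑ a ∈ A, ρ * (S.filter fun u : Fin n => m (4 * (u : ℕ) + 1) = a).card := by
        rw [hcard, Finset.mul_sum]
    _ ≤ ∑ a ∈ A, d := Finset.sum_le_sum hbound
    _ = A.card * d := by simp
    _ ≤ K * (n / d + 1) * d := by gcongr
    _ = K * (n / d * d + d) := by ring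
    _ ≤ K * (n + n) := by gcongr; exact Nat.div_mul_le_self _ _
    _ = 2 * K * n := by ring

open Classical in
-- The three terms match the three clauses of `Marks`: the centre of `v`, one remembered node for
-- each of at most `k` clusters, and the edges into missed clusters.
theorem card_marks_le (hm : MemoryOK L k m) (v : Fin n) :
    ({u | G.Adj v u ∧ Marks m v u} : Finset (Fin n)).card ≤ 1 + k +
      ({u | G.Adj v u ∧ m (4 * v) ≤ m (4 * u) ∧ m (tblIdx v (m (4 * u + 1))) = 0} :
      Finset (Fin n)).card := by
  have hsub : ({u | G.Adj v u ∧ Marks m v u} : Finset (Fin n)) ⊆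
      (({u | m (4 * v + 1) = (u : ℕ) + 1} : Finset (Fin n)) ∪
        ({u | m (tblIdx v (m (4 * u + 1))) = (u : ℕ) + 1} : Finset (Fin n))) ∪
      ({u | G.Adj v u ∧ m (4 * v) ≤ m (4 * u) ∧ m (tblIdx v (m (4 * u + 1))) = 0} :
        Finset (Fin n)) := by
    intro u hu
    simp only [Finset.mem_filter, Finset.mem_univ, true_and, Finset.mem_union] at hu ⊢
    unfold Marks at hu
    tauto
  refine (Finset.card_le_card hsub).trans ((Finset.card_union_le _ _).trans ?_)
  gcongr
  refine (Finset.card_union_le _ _).trans ?_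
  gcongr
  · rw [Finset.card_le_one]
    intro x hx y hy
    simp only [Finset.mem_filter, Finset.mem_univ, true_and] at hx hy
    exact Fin.ext (by omega)
  · calc _ ≤ ((Finset.range k).image fun i => m (4 * i + 2) + 1).card := by
          -- The centre code of a remembered node determines the table entry, and the entry names
          -- the node, so the code is injective here.
          refine Finset.card_le_card_of_injOn (fun u => m (4 * (u : ℕ) + 1)) ?_ ?_
          · intro u hu
            simp only [Finset.coe_filter, Finset.mem_univ, true_and, Set.mem_ofPred_eq] at hu
            rcases hm.row v v.2 _ (hm.ctr.le hm.smp u u.2) with h | ⟨h0, -⟩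
            · omega
            rcases hm.ctr u u.2 with ⟨h, -⟩ | ⟨j, hj, hc, -⟩
            · exact absurd h h0
            · simp only [Finset.coe_image, Set.mem_image, Finset.coe_range, Set.mem_Iio]
              exact ⟨j, hj, hc.symm⟩
          · intro x hx y hy hxy
            simp only [Finset.coe_filter, Finset.mem_univ, true_and, Set.mem_ofPred_eq] at hx hy hxy
            rw [hxy] at hx
            exact Fin.ext (by omega)
      _ ≤ k := Finset.card_image_le.trans (by simp)

theorem ncard_keptGraph_le {K ρ : ℕ} (hm : MemoryOK L k m) (hρ : 0 < ρ)
    (h1 : SamplesHit L K m) (h2 : ProbesHit L ρ m)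
    (hk : ∀ u < n, n ≤ L.degQuery u * L.degQuery u → K * (n / L.degQuery u + 1) ≤ k)
    {B : ℝ} (hB1 : ∀ v < n, L.degQuery v * L.degQuery v < n → (L.degQuery v : ℝ) ≤ B)
    (hB2 : 1 + k + 2 * K * n / ρ ≤ B) :
    ((keptGraph G m).edgeSet.ncard : ℝ) ≤ n * B := by
  classical
  have h := ncard_edgeSet_le (keptGraph G m) (fun v u => G.Adj v u ∧ Marks m v u)
    (fun u v h => h.2.imp (fun h' => ⟨h.1, h'⟩) fun h' => ⟨h.1.symm, h'⟩)
  calc ((keptGraph G m).edgeSet.ncard : ℝ)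
      ≤ ∑ v : Fin n, (({u | G.Adj v u ∧ Marks m v u} : Finset (Fin n)).card : ℝ) := by
        exact_mod_cast h
    _ ≤ ∑ v : Fin n, B := by
        refine Finset.sum_le_sum fun v _ => ?_
        by_cases hv : L.degQuery v * L.degQuery v < n
        · refine le_trans ?_ (hB1 v v.2 hv)
          rw [← L.card_adj]
          exact_mod_cast Finset.card_le_card fun u hu => by
            simp only [Finset.mem_filter, Finset.mem_univ, true_and] at hu ⊢
            exact hu.1
        · refine le_trans ?_ hB2
          have h3 := card_marks_le hm v
          have h4 := card_unhit_le hm h1 h2 hk v (not_lt.1 hv)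
          have h5 : (({u | G.Adj v u ∧ m (4 * v) ≤ m (4 * u) ∧
              m (tblIdx v (m (4 * u + 1))) = 0} : Finset (Fin n)).card : ℝ) ≤ 2 * K * n / ρ := by
            rw [le_div_iff₀ (by exact_mod_cast hρ), mul_comm]
            exact_mod_cast h4
          refine le_trans ?_ (add_le_add le_rfl h5)
          exact_mod_cast h3
    _ = n * B := by simp

end Oracle

/-! ## Probability of success -/

section Probability

variable {n : ℕ} {G : SimpleGraph (Fin n)} {L : AdjacencyList G}

/-- Outcomes outside the event contribute at least their full mass to the expectation, the
non-halting outcome included since its value is `⊤`. -/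
theorem one_sub_le_prob {p : PMF (Option MachineState)} {P : MachineState → Prop}
    [DecidablePred P] {ε : ℝ} (hε : 0 ≤ ε)
    (h : expect p (fun t => if P t then 0 else 1) ≤ ENNReal.ofReal ε) :
    1 - ε ≤ p.prob {o | ∃ s, o = some s ∧ P s} := by
  unfold PMF.prob
  set S : Set (Option MachineState) := {o | ∃ s, o = some s ∧ P s} with hS
  have h1 : (1 : ℝ≥0∞) ≤ p.toOuterMeasure S + ENNReal.ofReal ε := by
    refine le_trans ?_ (add_le_add le_rfl h)
    rw [PMF.toOuterMeasure_apply, expect, ← ENNReal.tsum_add, ← p.tsum_coe]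
    refine ENNReal.tsum_le_tsum fun o => ?_
    by_cases ho : o ∈ S
    · rw [Set.indicator_of_mem ho]; exact le_self_add
    · rw [Set.indicator_of_notMem ho, zero_add]
      refine le_mul_of_one_le_right zero_le ?_
      cases o with
      | none => exact le_top
      | some t =>
        have : ¬ P t := fun ht => ho ⟨t, rfl, ht⟩
        simp [this]
  have hfin : p.toOuterMeasure S ≠ ⊤ := by
    refine ne_top_of_le_ne_top ENNReal.one_ne_top ?_
    rw [PMF.toOuterMeasure_apply, ← p.tsum_coe]
    exact ENNReal.tsum_le_tsum fun o => Set.indicator_le_self _ _ _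
  have h2 := ENNReal.toReal_mono (ENNReal.add_ne_top.2 ⟨hfin, ENNReal.ofReal_ne_top⟩) h1
  rw [ENNReal.toReal_add hfin ENNReal.ofReal_ne_top, ENNReal.toReal_ofReal hε,
    ENNReal.toReal_one] at h2
  linarith

/-- From `1 - x ≤ exp (-x)` and `e ≥ 2`. -/
theorem ofReal_one_sub_pow_le {x : ℝ} {K N : ℕ} (hx : x ≤ 1) (h : K ≤ x * N) :
    ENNReal.ofReal (1 - x) ^ N ≤ ((2 : ℝ≥0∞) ^ K)⁻¹ := by
  have h1 : (1 - x) ^ N ≤ ((2 : ℝ) ^ K)⁻¹ := by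
    calc (1 - x) ^ N ≤ Real.exp (-x) ^ N := by
          exact pow_le_pow_left₀ (by linarith) (Real.one_sub_le_exp_neg x) N
      _ = Real.exp (-(x * N)) := by rw [← Real.exp_nat_mul]; ring_nf
      _ ≤ Real.exp (-K) := by gcongr
      _ = (Real.exp 1 ^ K)⁻¹ := by rw [← Real.exp_nat_mul, mul_one, Real.exp_neg]
      _ ≤ ((2 : ℝ) ^ K)⁻¹ := by
          gcongr
          have := Real.add_one_le_exp 1
          linarith
  rw [← ENNReal.ofReal_pow (by linarith)]
  refine (ENNReal.ofReal_le_ofReal h1).trans (le_of_eq ?_)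
  rw [ENNReal.ofReal_inv_of_pos (by positivity), ENNReal.ofReal_pow (by norm_num)]
  norm_num

theorem AdjacencyList.card_not_adjQuery (L : AdjacencyList G) {u : ℕ} :
    ({c ∈ Finset.range n | adjQuery G c u ≠ 1} : Finset ℕ).card + L.degQuery u = n := by
  have e : ({c ∈ Finset.range n | adjQuery G c u = 1} : Finset ℕ) =
      (Finset.range (L.degQuery u)).image (L.nbrQuery u) := by
    ext c
    simp only [Finset.mem_filter, Finset.mem_range, Finset.mem_image, L.exists_nbrQuery_eq_iff]
    rw [adjQuery_comm G c u]
    refine ⟨fun h => h.2, fun h => ⟨?_, h⟩⟩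
    unfold adjQuery at h
    split_ifs at h with h'
    exact h'.2.1
  have h1 : ({c ∈ Finset.range n | adjQuery G c u = 1} : Finset ℕ).card = L.degQuery u := by
    rw [e, Finset.card_image_of_injOn, Finset.card_range]
    simpa using L.nbrQuery_injOn u
  have h2 := Finset.card_filter_add_card_filter_not (s := Finset.range n)
    (fun c => adjQuery G c u = 1)
  rw [h1, Finset.card_range] at h2
  simp only [ne_eq]
  omega

open Classical in
-- If a cluster contains at least a fraction `1/ρ` of the neighbours of `v`, a uniform position in
-- the list of `v` misses it with probability at most `1 - 1/ρ`.
theorem card_probe_miss_le {ρ a : ℕ} {C : ℕ → ℕ} (hρ : 0 < ρ) (v : Fin n)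
    (h : L.degQuery v ≤ ρ * ({u | G.Adj v u ∧ C u = a} : Finset (Fin n)).card) :
    ((({i ∈ Finset.range (L.degQuery v) | C (L.nbrQuery v i) ≠ a} : Finset ℕ).card : ℝ≥0∞))
      ≤ ENNReal.ofReal (1 - 1 / ρ) * L.degQuery v := by
  have h1 : ({u | G.Adj v u ∧ C u = a} : Finset (Fin n)).card ≤
      ({i ∈ Finset.range (L.degQuery v) | C (L.nbrQuery v i) = a} : Finset ℕ).card := by
    rw [← Finset.card_image_of_injective ({u | G.Adj v u ∧ C u = a} : Finset (Fin n))
      Fin.val_injective]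
    refine (Finset.card_le_card ?_).trans (Finset.card_image_le (f := L.nbrQuery v))
    intro u hu
    simp only [Finset.mem_image, Finset.mem_filter, Finset.mem_univ, true_and] at hu
    obtain ⟨u, ⟨hA, hC⟩, rfl⟩ := hu
    obtain ⟨i, hi, hiu⟩ := L.exists_nbrQuery_eq_iff.2 ((adjQuery_fin G v u).2 hA)
    simp only [Finset.mem_image, Finset.mem_filter, Finset.mem_range]
    exact ⟨i, ⟨hi, by rw [hiu, hC]⟩, hiu⟩
  have h2 := Finset.card_filter_add_card_filter_not (s := Finset.range (L.degQuery v))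
    (fun i => C (L.nbrQuery v i) = a)
  rw [Finset.card_range] at h2
  set x := ({i ∈ Finset.range (L.degQuery v) | C (L.nbrQuery v i) = a} : Finset ℕ).card
  have h3 : L.degQuery v ≤ ρ * x := h.trans (Nat.mul_le_mul_left _ h1)
  simp only [ne_eq]
  set y := ({i ∈ Finset.range (L.degQuery v) | ¬ C (L.nbrQuery v i) = a} : Finset ℕ).card
  have hρ' : (0 : ℝ) < ρ := by exact_mod_cast hρ
  have hρ1 : (1 : ℝ) / ρ ≤ 1 := by
    rw [div_le_one hρ']; exact_mod_cast hρ
  rw [← ENNReal.ofReal_natCast y, ← ENNReal.ofReal_natCast (L.degQuery v),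
    ← ENNReal.ofReal_mul (by linarith)]
  refine ENNReal.ofReal_le_ofReal ?_
  have h4 : (x : ℝ) + y = L.degQuery v := by exact_mod_cast h2
  have h5 : (L.degQuery v : ℝ) / ρ ≤ x := by
    rw [div_le_iff₀ hρ', mul_comm]; exact_mod_cast h3
  have : (1 - 1 / (ρ : ℝ)) * L.degQuery v = L.degQuery v - L.degQuery v / ρ := by ring
  linarith

/-- The sum of all degrees. -/
def AdjacencyList.degSum (L : AdjacencyList G) : ℕ := ∑ c ∈ Finset.range n, L.degQuery c

/-- Deterministic half of a Chernoff bound: the product is the exponential moment to which Markov's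
inequality is applied, and taking logarithms turns a bound on it into a bound on the sum. -/
theorem sum_le_of_prod_le {n K k : ℕ} (hn : 0 < n) {d : ℕ → ℕ} (hd : ∀ i < k, d i ≤ n) {y : ℝ}
    (hy : 0 ≤ y) (h : ∏ i ∈ Finset.range k, (1 + (d i : ℝ) / n) ≤ 2 ^ K * (1 + y) ^ k) :
    ((∑ i ∈ Finset.range k, d i : ℕ) : ℝ) ≤ 2 * n * (K + k * y) := by
  have hn' : (0 : ℝ) < n := by exact_mod_cast hn
  have hpos : ∀ i, (0 : ℝ) < 1 + (d i : ℝ) / n := fun i => by positivity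
  have h1 := Real.log_le_log (Finset.prod_pos fun i _ => hpos i) h
  rw [Real.log_prod (fun i _ => (hpos i).ne'), Real.log_mul (by positivity) (by positivity),
    Real.log_pow, Real.log_pow] at h1
  have h2 : Real.log 2 ≤ 1 := by
    have := Real.log_le_sub_one_of_pos (show (0 : ℝ) < 2 by norm_num)
    linarith
  have h3 : Real.log (1 + y) ≤ y := by
    have := Real.log_le_sub_one_of_pos (show (0 : ℝ) < 1 + y by linarith)
    linarith
  -- For `0 ≤ x ≤ 1`, `log (1 + x) ≥ x / (1 + x) ≥ x / 2`; this is where the factor 2 in the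
  -- conclusion comes from.
  have h4 : ∀ i ∈ Finset.range k, (d i : ℝ) / n / 2 ≤ Real.log (1 + (d i : ℝ) / n) := by
    intro i hi
    have hdi : (d i : ℝ) / n ≤ 1 := by
      rw [div_le_one hn']
      exact_mod_cast hd i (Finset.mem_range.1 hi)
    have hdi0 : 0 ≤ (d i : ℝ) / n := by positivity
    refine le_trans ?_ (Real.one_sub_inv_le_log_of_pos (hpos i))
    have : 1 - (1 + (d i : ℝ) / n)⁻¹ = (d i : ℝ) / n / (1 + (d i : ℝ) / n) := by
      field_simp
      ring
    rw [this]
    gcongr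
    linarith
  have h5 := Finset.sum_le_sum h4
  rw [← Finset.sum_div, ← Finset.sum_div] at h5
  push_cast
  have h6 : (∑ i ∈ Finset.range k, (d i : ℝ)) / n / 2 ≤ K + k * y := by
    have : (K : ℝ) * Real.log 2 ≤ K * 1 := by gcongr
    have : (k : ℝ) * Real.log (1 + y) ≤ k * y := by gcongr
    linarith
  rw [div_div, div_le_iff₀ (by positivity)] at h6
  linarith

/-- The total degree of the sampled centres is close to its expectation. -/
def ScanBounded (L : AdjacencyList G) (K k : ℕ) (m : ℕ → ℕ) : Prop :=
  ((∑ i ∈ Finset.range k, L.degQuery (m (4 * i + 2)) : ℕ) : ℝ) ≤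
    2 * n * (K + k * ((L.degSum : ℝ) / n ^ 2))

open Classical in
-- Once the samples are fixed, their quality is a 0/1 constant, and the clusters are determined
-- before any probing. Only the probes are random: at most `n * n` pairs of a node and a large
-- cluster, each missed with probability at most `2^{-K}`.
theorem wp_scan_probe_le {F V K k ρ τ : ℕ} {f : MachineState → ℝ≥0∞} {s : MachineState}
    (hn : 0 < n) (hρ : 0 < ρ) (hF : n < F) (hkF : k < F) (hRF : K * ρ < F)
    (hV : 16 * (n * n) + 8 * n + 8 ≤ V) (hkV : 4 * k + 4 ≤ V) (hRV : K * ρ < V)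
    (hρV : ρ ≤ V) (hKV : K ≤ V)
    (h0 : s.reg 0 = n) (h1 : s.reg 1 = ρ) (h2 : s.reg 2 = K) (h5 : s.reg 5 = k)
    (hdeg : ∀ v < n, s.mem (4 * v) = L.degQuery v) (hS : ∀ j < k, s.mem (4 * j + 2) < n)
    (hC : ∀ u < n, s.mem (4 * u + 1) = 0) (hT : ∀ v < n, ∀ a ≤ n, s.mem (tblIdx v a) = 0)
    (hτ : s.time ≤ τ) (hf : ∀ t, f t ≤ 1)
    (good : ∀ t, MemoryOK L k t.mem → SamplesHit L K t.mem → ProbesHit L ρ t.mem →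
      ScanBounded L K k t.mem →
      t.time ≤ τ + (V.size + 1) * (80 * (∑ j ∈ Finset.range k, L.degQuery (t.mem (4 * j + 2))
        + k + 1)) + (V.size + 1) * (100 * (n * (K * ρ + 1))) → f t = 0) :
    wp L F (.seq scanCmd probeCmd) f s ≤ n * (n * ((2 : ℝ≥0∞) ^ K)⁻¹) +
      if SamplesHit L K s.mem ∧ ScanBounded L K k s.mem then 0 else 1 := by
  set b : ℝ≥0∞ := if SamplesHit L K s.mem ∧ ScanBounded L K k s.mem then 0 else 1 with hb
  rw [wp_seq]
  refine wp_scanCmd_le hn hF hkF hV hkV h5 hS hC fun r m τ₁ hr hm hctr hτ₁ => ?_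
  have hmS : ∀ i, m (4 * i + 2) = s.mem (4 * i + 2) := fun i => hm _ (by omega)
  have hCn : ∀ u < n, m (4 * u + 1) ≤ n := hctr.le fun j hj => by rw [hmS]; exact hS j hj
  have hr0 : r 0 = n := by rw [hr 0 (by simp) (by simp) (by simp) (by simp), h0]
  have hr1 : r 1 = ρ := by rw [hr 1 (by simp) (by simp) (by simp) (by simp), h1]
  have hr2 : r 2 = K := by rw [hr 2 (by simp) (by simp) (by simp) (by simp), h2]
  set X : ℕ → Finset ℕ := fun v => {a ∈ Finset.Icc 1 n | n ≤ L.degQuery v * L.degQuery v ∧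
    L.degQuery v ≤ ρ * ({u | adjQuery G v u = 1 ∧ m (4 * u + 1) = a} : Finset (Fin n)).card} with hX
  refine (wp_probeCmd_le (R := K * ρ) (b := b) hn hF hRF hV hRV (by simp only; omega)
    (by simp only; omega) hr0 (by simp only [hr1, hr2]) hCn ?_ X (ENNReal.ofReal (1 - 1 / ρ))
    ?_ ?_).trans ?_
  · intro v hv a ha
    simp only
    rw [hm _ (by rw [tblIdx_mod]; omega), hT v hv a ha]
  · intro v hv a ha
    simp only [hX, Finset.mem_filter, Finset.mem_Icc] at ha
    refine ⟨ha.2.1, by omega, ha.1.2, ?_⟩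
    refine card_probe_miss_le (C := fun u => m (4 * u + 1)) hρ ⟨v, hv⟩ ?_
    have := ha.2.2
    simp only [show ∀ u : Fin n, adjQuery G v u = 1 ↔ G.Adj ⟨v, hv⟩ u from
      fun u => adjQuery_fin G ⟨v, hv⟩ u] at this
    exact this
  · intro r' m' τ' hm' hrow hlow hτ'
    by_cases hg : SamplesHit L K s.mem ∧ ScanBounded L K k s.mem
    · by_cases hp : ProbesHit L ρ m'
      · refine le_trans (le_of_eq ?_) zero_le
        have hmt : ∀ a, a % 4 ≠ 3 → m' a = m a := fun a ha => hm' a fun v _ a' _ h => by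
          have := tblIdx_mod v a'; omega
        have hmS' : ∀ i, m' (4 * i + 2) = s.mem (4 * i + 2) := fun i => by
          rw [hmt _ (by omega), hmS]
        refine good ⟨r', m', τ'⟩ ⟨fun v hv => ?_, fun j hj => ?_, fun u hu => ?_, hrow, hlow⟩
          ?_ hp ?_ ?_
        · simp only
          rw [hmt _ (by omega), hm _ (by omega), hdeg v hv]
        · simp only [hmS']; exact hS j hj
        · have := hctr u hu
          simp only [hmS] at this
          simp only [hmS', hmt _ (show (4 * u + 1) % 4 ≠ 3 by omega)]
          exact this
        · intro u hu hd
          simp only [hmS']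
          exact hg.1 u hu hd
        · simp only [ScanBounded, hmS']
          exact hg.2
        · simp only [hmS']
          simp only at hτ'
          omega
      · refine (hf _).trans (le_add_of_nonneg_of_le zero_le ?_)
        unfold ProbesHit at hp
        push Not at hp
        obtain ⟨v, hv, a, ha, ha0, hva, hz⟩ := hp
        have hCm : ∀ u, m' (4 * u + 1) = m (4 * u + 1) := fun u => hm' _ fun v _ a' _ h => by
          have := tblIdx_mod v a'; omega
        have haX : a ∈ X v := by
          simp only [hX, Finset.mem_filter, Finset.mem_Icc, adjQuery_fin]
          simp only [hCm] at hva
          exact ⟨⟨by omega, ha⟩, hv, hva⟩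
        calc (1 : ℝ≥0∞) = if m' (tblIdx v a) = 0 then 1 else 0 := by rw [if_pos hz]
          _ ≤ ∑ a ∈ X v, if m' (tblIdx v a) = 0 then 1 else 0 :=
            Finset.single_le_sum (f := fun a => if m' (tblIdx v a) = 0 then (1 : ℝ≥0∞) else 0)
              (fun _ _ => zero_le) haX
          _ ≤ _ := Finset.single_le_sum
            (f := fun v => ∑ a ∈ X v, if m' (tblIdx v a) = 0 then (1 : ℝ≥0∞) else 0)
              (fun _ _ => zero_le) (Finset.mem_range.2 v.2)
    · refine (hf _).trans (le_add_of_le_of_nonneg ?_ zero_le)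
      rw [hb, if_neg hg]
  · rw [add_comm]
    refine add_le_add ?_ le_rfl
    have hq : ENNReal.ofReal (1 - 1 / ρ) ^ (K * ρ) ≤ ((2 : ℝ≥0∞) ^ K)⁻¹ := by
      have hρ' : (0 : ℝ) < ρ := by exact_mod_cast hρ
      refine ofReal_one_sub_pow_le ?_ ?_
      · rw [div_le_one hρ']; exact_mod_cast hρ
      · push_cast
        field_simp
        exact le_rfl
    calc _ ≤ ∑ v ∈ Finset.range n, (n : ℝ≥0∞) * ((2 : ℝ≥0∞) ^ K)⁻¹ := by
          refine Finset.sum_le_sum fun v _ => ?_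
          gcongr
          refine (Finset.card_filter_le _ _).trans ?_
          simp
      _ = _ := by simp

open Classical in
-- Union bound over all failures: `n²` for the probes, `n` for nodes of large degree without an
-- early centre, one for an excessive total degree of the centres.
theorem wp_sample_scan_probe_le {F V K k ρ mm τ : ℕ} {f : MachineState → ℝ≥0∞} {s : MachineState}
    (hn : 0 < n) (hρ : 0 < ρ) (hF : n < F) (hkF : k < F) (hRF : K * ρ < F)
    (hV : 16 * (n * n) + 8 * n + 8 ≤ V) (hkV : 4 * k + 4 ≤ V) (hRV : K * ρ < V)
    (hρV : ρ ≤ V) (hKV : K ≤ V) (hmm : IsDegreeBound L n mm) (hk : k = K * (n / mm + 1))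
    (h0 : s.reg 0 = n) (h1 : s.reg 1 = ρ) (h2 : s.reg 2 = K) (h4 : s.reg 4 = mm)
    (hdeg : ∀ v < n, s.mem (4 * v) = L.degQuery v)
    (hC : ∀ u < n, s.mem (4 * u + 1) = 0) (hT : ∀ v < n, ∀ a ≤ n, s.mem (tblIdx v a) = 0)
    (hτ : s.time ≤ τ) (hf : ∀ t, f t ≤ 1)
    (good : ∀ t, MemoryOK L k t.mem → SamplesHit L K t.mem → ProbesHit L ρ t.mem →
      ScanBounded L K k t.mem →
      t.time ≤ τ + (V.size + 1) * (40 * (k + 1)) + (V.size + 1) *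
        (80 * (∑ j ∈ Finset.range k, L.degQuery (t.mem (4 * j + 2)) + k + 1)) +
        (V.size + 1) * (100 * (n * (K * ρ + 1))) → f t = 0) :
    wp L F (.seq sampleCmd (.seq scanCmd probeCmd)) f s ≤
      ENNReal.ofReal ((n + 1) ^ 2 * ((2 : ℝ) ^ K)⁻¹) := by
  have hn' : (0 : ℝ) < n := by exact_mod_cast hn
  set y : ℝ := (L.degSum : ℝ) / n ^ 2 with hy
  have hy0 : 0 ≤ y := by positivity
  set Ku : ℕ → ℕ := fun u => K * (n / L.degQuery u + 1) with hKu
  -- `some u` is the event that the first `Ku u` samples all miss the neighbourhood of `u`; `none`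
  -- is the event that the total degree of the samples is too large.
  set X : Finset (Option ℕ) := Finset.insertNone
    {u ∈ Finset.range n | n ≤ L.degQuery u * L.degQuery u} with hX
  -- The weight at `none` is Markov's inequality: the product of the factors `1 + deg/n` has mean
  -- `(1 + y)^k` and is compared with `2^K` times this mean.
  set w : Option ℕ → ℝ≥0∞ := fun x => x.elim (ENNReal.ofReal (2 ^ K * (1 + y) ^ k))⁻¹
    (fun _ => 1) with hw
  set g : Option ℕ → ℕ → ℕ → ℝ≥0∞ := fun x i c => x.elim (ENNReal.ofReal (1 + L.degQuery c / n))
    (fun u => if i < Ku u then (if adjQuery G c u ≠ 1 then 1 else 0) else 1) with hg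
  set q : Option ℕ → ℕ → ℝ≥0∞ := fun x i => x.elim (ENNReal.ofReal (1 + y))
    (fun u => if i < Ku u then ENNReal.ofReal (1 - L.degQuery u / n) else 1) with hq
  have hKk : ∀ u < n, n ≤ L.degQuery u * L.degQuery u → Ku u ≤ k := by
    intro u hu hd
    change K * (n / L.degQuery u + 1) ≤ k
    rw [hk]
    have := hmm.le_deg u hu hd
    have := hmm.pos
    gcongr
  rw [wp_seq]
  refine (wp_sampleCmd_le (b := n * (n * ((2 : ℝ≥0∞) ^ K)⁻¹)) (K := K) (k := k) hn hkF hV hkV hKV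
    h0 h2 h4 hmm.le hk X w g q ?_ ?_).trans ?_
  · intro x hx i hi
    cases x with
    | none =>
      simp only [hg, hq, Option.elim_none]
      rw [← ENNReal.ofReal_sum_of_nonneg (fun c _ => by positivity), ← ENNReal.ofReal_natCast n,
        ← ENNReal.ofReal_mul (by positivity)]
      refine ENNReal.ofReal_le_ofReal (le_of_eq ?_)
      rw [Finset.sum_add_distrib, ← Finset.sum_div, hy, AdjacencyList.degSum]
      simp only [Finset.sum_const, Finset.card_range, nsmul_eq_mul, mul_one]
      push_cast
      field_simp
    | some u =>
      simp only [hg, hq, Option.elim_some]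
      split_ifs with hiu
      · rw [Finset.sum_boole]
        have h := L.card_not_adjQuery (u := u)
        set z := ({c ∈ Finset.range n | adjQuery G c u ≠ 1} : Finset ℕ).card
        have h' : (z : ℝ) + L.degQuery u = n := by exact_mod_cast h
        rw [← ENNReal.ofReal_natCast n, ← ENNReal.ofReal_natCast z,
          ← ENNReal.ofReal_mul (by positivity)]
        refine ENNReal.ofReal_le_ofReal (le_of_eq ?_)
        field_simp
        linarith
      · simp
  · intro r m τ₁ hr hr5 hm hS hτ₁
    refine (wp_scan_probe_le (L := L) (τ := τ + (V.size + 1) * (40 * (k + 1))) hn hρ hF hkF hRF hV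
      hkV hRV hρV hKV ((hr 0 (by simp) (by simp) (by simp)).trans h0)
      ((hr 1 (by simp) (by simp) (by simp)).trans h1)
      ((hr 2 (by simp) (by simp) (by simp)).trans h2) hr5
      (fun v hv => by simp only; rw [hm _ (by omega), hdeg v hv]) hS
      (fun u hu => by simp only; rw [hm _ (by omega), hC u hu])
      (fun v hv a ha => by simp only; rw [hm _ (by rw [tblIdx_mod]; omega), hT v hv a ha])
      (by simp only; omega) hf good).trans ?_
    refine add_le_add le_rfl ?_
    split_ifs with hgood
    · exact zero_le
    simp only [not_and_or] at hgood
    rcases hgood with hgood | hgood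
    · unfold SamplesHit at hgood
      push Not at hgood
      obtain ⟨u, hu, hd, hno⟩ := hgood
      have hmem : some u ∈ X := by
        simp [hX, hu, hd]
      refine le_trans (le_of_eq ?_) (Finset.single_le_sum
        (f := fun x => w x * ∏ i ∈ Finset.range k, g x i (m (4 * i + 2)))
        (fun _ _ => zero_le) hmem)
      simp only [hw, hg, Option.elim_some, one_mul]
      rw [Finset.prod_eq_one]
      intro i _
      split_ifs with h6 h7
      · rfl
      · exact absurd (not_not.1 h7) (hno i h6)
      · rfl
    · have hmem : none ∈ X := by simp [hX]
      refine le_trans ?_ (Finset.single_le_sum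
        (f := fun x => w x * ∏ i ∈ Finset.range k, g x i (m (4 * i + 2)))
        (fun _ _ => zero_le) hmem)
      simp only [hw, hg, Option.elim_none]
      rw [← ENNReal.ofReal_prod_of_nonneg (fun i _ => by positivity), mul_comm,
        ← div_eq_mul_inv, ENNReal.le_div_iff_mul_le (.inl (by simp; positivity))
        (.inl ENNReal.ofReal_ne_top), one_mul]
      refine ENNReal.ofReal_le_ofReal ?_
      by_contra hlt
      push Not at hlt
      exact hgood (sum_le_of_prod_le hn (fun i _ => L.degQuery_le _) hy0 hlt.le)
  · have e1 : ∑ x ∈ X, w x * ∏ i ∈ Finset.range k, q x i ≤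
        ((2 : ℝ≥0∞) ^ K)⁻¹ + n * ((2 : ℝ≥0∞) ^ K)⁻¹ := by
      rw [hX, Finset.sum_insertNone]
      refine add_le_add ?_ ?_
      · simp only [hw, hq, Option.elim_none, Finset.prod_const, Finset.card_range]
        rw [← ENNReal.ofReal_pow (by positivity), ENNReal.ofReal_mul (by positivity),
          ENNReal.mul_inv (.inr (by simp)) (.inl (by simp)), mul_assoc,
          ENNReal.inv_mul_cancel (by simp; positivity) (by simp), mul_one,
          ENNReal.ofReal_pow (by norm_num)]
        norm_num
      · calc _ ≤ ∑ u ∈ {u ∈ Finset.range n | n ≤ L.degQuery u * L.degQuery u},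
              ((2 : ℝ≥0∞) ^ K)⁻¹ := by
              refine Finset.sum_le_sum fun u hu => ?_
              rw [Finset.mem_filter, Finset.mem_range] at hu
              simp only [hw, hq, Option.elim_some, one_mul]
              rw [Finset.prod_ite]
              have e2 : ({i ∈ Finset.range k | i < Ku u} : Finset ℕ) = Finset.range (Ku u) := by
                ext i
                have := hKk u hu.1 hu.2
                simp only [Finset.mem_filter, Finset.mem_range]
                omega
              rw [e2, Finset.prod_const_one, mul_one, Finset.prod_const, Finset.card_range]
              have hdpos : 0 < L.degQuery u := by
                by_contra h
                have : L.degQuery u = 0 := by omega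
                rw [this] at hu
                omega
              refine ofReal_one_sub_pow_le ?_ ?_
              · rw [div_le_one hn']; exact_mod_cast L.degQuery_le u
              · rw [div_mul_eq_mul_div, le_div_iff₀ hn']
                have h6 : n ≤ L.degQuery u * (n / L.degQuery u + 1) := by
                  have := Nat.lt_mul_div_succ n hdpos
                  omega
                have h7 : K * n ≤ L.degQuery u * Ku u := by
                  calc K * n ≤ K * (L.degQuery u * (n / L.degQuery u + 1)) := by gcongr
                    _ = _ := by rw [hKu]; ring
                exact_mod_cast h7
          _ ≤ _ := by
              rw [Finset.sum_const, nsmul_eq_mul]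
              gcongr
              refine (Finset.card_filter_le _ _).trans ?_
              simp
    refine (add_le_add le_rfl e1).trans ?_
    have e3 : ENNReal.ofReal ((n + 1) ^ 2 * ((2 : ℝ) ^ K)⁻¹) =
        (n + 1) ^ 2 * ((2 : ℝ≥0∞) ^ K)⁻¹ := by
      rw [ENNReal.ofReal_mul (by positivity), ENNReal.ofReal_inv_of_pos (by positivity),
        ENNReal.ofReal_pow (by positivity), ENNReal.ofReal_pow (by positivity),
        ENNReal.ofReal_add (by positivity) (by norm_num)]
      norm_num
    rw [e3]
    calc _ = ((n : ℝ≥0∞) * n + n + 1) * ((2 : ℝ≥0∞) ^ K)⁻¹ := by ring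
      _ ≤ (n * n + n + 1 + n) * ((2 : ℝ≥0∞) ^ K)⁻¹ := mul_le_mul' le_self_add le_rfl
      _ = _ := by ring

open Classical in
-- `V` bounds every number handled after the parameter is capped: table addresses are quadratic in
-- `n`, and `k` and the number of probes per node are at most of order `A n²`.
theorem wp_prepCmd_le {A F V r : ℕ} {f : MachineState → ℝ≥0∞} (hn : 0 < n) (hr : 0 < r)
    (hV : (32 + 8 * A) * (n + 1) ^ 2 ≤ V) (hF : V ≤ F) (hf : ∀ t, f t ≤ 1)
    (good : ∀ t mm k, IsDegreeBound L n mm → k = A * n.size * (n / mm + 1) → MemoryOK L k t.mem →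
      SamplesHit L (A * n.size) t.mem → ProbesHit L (min n r) t.mem →
      ScanBounded L (A * n.size) k t.mem →
      t.time ≤ 8 * (n + r + 2) + (V.size + 1) * (10 * (n.size + 1) + 40 * (n + 1) + 40 * (k + 1) +
        80 * (∑ j ∈ Finset.range k, L.degQuery (t.mem (4 * j + 2)) + k + 1) +
        100 * (n * (A * n.size * min n r + 1))) → f t = 0) :
    wp L F (prepCmd A) f (startState (fun _ => 0) n r) ≤
      ENNReal.ofReal ((n + 1) ^ 2 * ((2 : ℝ) ^ (A * n.size))⁻¹) := by
  have hsz : n.size ≤ n := Nat.size_le.2 Nat.lt_two_pow_self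
  have hK : A * n.size ≤ A * n := Nat.mul_le_mul_left _ hsz
  have hV1 : 16 * (n * n) + 8 * n + 8 ≤ V := by nlinarith [Nat.zero_le (A * (n + 1) ^ 2)]
  have hV2 : n + 2 + A * n.size + A ≤ V := by nlinarith [Nat.zero_le (A * (n ^ 2 + n))]
  have hV3 : ∀ mm, 4 * (A * n.size * (n / mm + 1)) + 4 ≤ V := by
    intro mm
    have h1 : A * n.size * (n / mm + 1) ≤ A * n * (n + 1) := by
      gcongr
      exact Nat.div_le_self _ _
    nlinarith [Nat.zero_le (A * (n + 1))]
  have hρn : min n r ≤ n := min_le_left _ _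
  have hV4 : A * n.size * min n r < V := by
    have h1 : A * n.size * min n r ≤ A * n * n := by gcongr
    nlinarith [Nat.zero_le (A * (n + 1))]
  unfold prepCmd
  rw [wp_seq]
  refine wp_capCmd_le (by simp [startState]) fun r₁ τ₁ hr₁ hρ₁ hτ₁ => ?_
  rw [wp_seq]
  refine wp_logCmd_le (V := V) (by omega) hV2 (hr₁ 0 (by simp)) (hr₁ 2 (by simp)) fun r₂ τ₂ hr₂ hK₂ hτ₂ => ?_
  have h20 : r₂ 0 = n := by
    rw [hr₂ 0 (by simp) (by simp)]; simp only; rw [hr₁ 0 (by simp)]; simp [startState]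
  have h21 : r₂ 1 = min n r := by
    rw [hr₂ 1 (by simp) (by simp)]; simp only; rw [hρ₁]; simp [startState]
  rw [wp_seq]
  refine wp_degCmd_le hn (by omega) hV1 h20 fun r₃ m₃ τ₃ hr₃ hmm hdeg hmem hτ₃ => ?_
  have hz : ∀ a, a % 4 ≠ 0 → m₃ a = 0 := fun a ha => by rw [hmem a ha]; rfl
  refine wp_sample_scan_probe_le (L := L) (τ := 8 * (n + r + 2) + (V.size + 1) *
    (10 * (n.size + 1)) + (V.size + 1) * (40 * (n + 1))) hn (lt_min hn hr) (by omega)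
    (by have := hV3 (r₃ 4); omega) (by omega) hV1 (hV3 (r₃ 4)) hV4 (by omega) (by omega) hmm rfl
    ((hr₃ 0 (by simp) (by simp)).trans h20) ((hr₃ 1 (by simp) (by simp)).trans h21)
    ((hr₃ 2 (by simp) (by simp)).trans hK₂) rfl hdeg (fun u _ => hz _ (by omega))
    (fun v _ a _ => hz _ (by rw [tblIdx_mod]; omega)) ?_ hf fun t h1 h2 h3 h4 h5 => ?_
  · simp only [startState] at hτ₁ hτ₂ hτ₃ ⊢
    simp only [one_ne_zero, if_false, if_true] at hτ₁
    omega
  · refine good t (r₃ 4) _ hmm rfl h1 h2 h3 h4 (h5.trans (le_of_eq ?_))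
    ring

end Probability

/-! ## The bounds of the theorem -/

section Bounds

/-- A number polynomial in `n` has bit length `O(log n)`; `log (n + 2) ≥ 1` absorbs the additive
constants. -/
theorem size_add_one_le (A n : ℕ) (hn : 0 < n) :
    ((((32 + 8 * A) * (n + 1) ^ 2).size + 1 : ℕ) : ℝ) ≤
      (2 * Real.log (32 + 8 * A) + 8) * Real.log (n + 2) := by
  set V := (32 + 8 * A) * (n + 1) ^ 2 with hV
  have hVpos : 0 < V := by positivity
  have hn1 : (1 : ℝ) ≤ n := by exact_mod_cast hn
  have hl : 1 ≤ Real.log (n + 2) := by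
    rw [Real.le_log_iff_exp_le (by positivity)]
    have := Real.exp_one_lt_d9
    linarith
  have h1 : 2 ^ (V.size - 1) ≤ V := by
    apply Nat.lt_size.1
    have := Nat.size_pos.2 hVpos
    omega
  have h2 : ((V.size - 1 : ℕ) : ℝ) * Real.log 2 ≤ Real.log V := by
    rw [← Real.log_pow]
    exact Real.log_le_log (by positivity) (by exact_mod_cast h1)
  have h3 : Real.log V = Real.log (32 + 8 * A) + 2 * Real.log (n + 1) := by
    rw [hV]; push_cast
    rw [Real.log_mul (by positivity) (by positivity), Real.log_pow]; norm_num
  have h4 : Real.log (n + 1) ≤ Real.log (n + 2) := Real.log_le_log (by positivity) (by linarith)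
  have h5 : 0 ≤ Real.log (32 + 8 * (A : ℝ)) := Real.log_nonneg (by
    have : (0 : ℝ) ≤ A := by positivity
    linarith)
  have h6 := Real.log_two_gt_d9
  have h7 : (V.size : ℝ) ≤ ((V.size - 1 : ℕ) : ℝ) + 1 := by
    have : V.size ≤ (V.size - 1) + 1 := by omega
    exact_mod_cast this
  have h8 : (0 : ℝ) ≤ ((V.size - 1 : ℕ) : ℝ) := by positivity
  push_cast
  nlinarith

/-- `2 ^ n.size ≥ n` gives `2^{-K} ≤ n^{-A}`, and `(n + 1)^2 ≤ n^4` for `n ≥ 2`; this is the origin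
of the `4` in `c + 4 ≤ A`. -/
theorem failure_le {c : ℝ} {A n : ℕ} (hA : c + 4 ≤ A) (hn : 2 ≤ n) :
    ((n : ℝ) + 1) ^ 2 * ((2 : ℝ) ^ (A * n.size))⁻¹ ≤ 1 / (n : ℝ) ^ c := by
  have hn2 : (2 : ℝ) ≤ n := by exact_mod_cast hn
  have hn0 : (0 : ℝ) < n := by linarith
  have h1 : (n : ℝ) ^ A ≤ (2 : ℝ) ^ (A * n.size) := by
    rw [mul_comm, pow_mul]
    gcongr
    exact_mod_cast (Nat.lt_size_self n).le
  have h2 : ((n : ℝ) + 1) ^ 2 ≤ (n : ℝ) ^ 4 := by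
    have : (n : ℝ) + 1 ≤ n ^ 2 := by nlinarith
    calc ((n : ℝ) + 1) ^ 2 ≤ ((n : ℝ) ^ 2) ^ 2 := by gcongr
      _ = _ := by ring
  rw [← div_eq_mul_inv, div_le_div_iff₀ (by positivity) (by positivity), one_mul]
  calc ((n : ℝ) + 1) ^ 2 * (n : ℝ) ^ c ≤ (n : ℝ) ^ 4 * (n : ℝ) ^ c := by gcongr
    _ = (n : ℝ) ^ (c + 4) := by rw [Real.rpow_add hn0, mul_comm]; norm_cast
    _ ≤ (n : ℝ) ^ (A : ℝ) := Real.rpow_le_rpow_of_exponent_le (by linarith) hA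
    _ = (n : ℝ) ^ A := Real.rpow_natCast _ _
    _ ≤ _ := h1

variable {n : ℕ} {G : SimpleGraph (Fin n)} {L : AdjacencyList G}

theorem averageDegree_eq [DecidableRel G.Adj] (L : AdjacencyList G) :
    averageDegree G = (L.degSum : ℝ) / n := by
  unfold averageDegree AdjacencyList.degSum
  rw [← Fin.sum_univ_eq_sum_range]
  push_cast
  simp [L.degQuery_eq_degree]

theorem averageDegree_nonneg (G : SimpleGraph (Fin n)) [DecidableRel G.Adj] :
    0 ≤ averageDegree G := by
  unfold averageDegree; positivity

theorem averageDegree_le (G : SimpleGraph (Fin n)) [DecidableRel G.Adj] : averageDegree G ≤ n := by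
  unfold averageDegree
  refine div_le_of_le_mul₀ (by positivity) (by positivity) ?_
  calc ∑ v, (G.degree v : ℝ) ≤ ∑ v : Fin n, (n : ℝ) := by
        refine Finset.sum_le_sum fun v _ => ?_
        exact_mod_cast (G.degree_lt_card_verts v).le.trans (by simp)
    _ = n * n := by simp

theorem minDegree_le_card [DecidableRel G.Adj] (hn : 0 < n) : G.minDegree ≤ n :=
  (G.minDegree_le_degree ⟨0, hn⟩).trans ((G.degree_lt_card_verts _).le.trans (by simp))

theorem degreeFloor_le [DecidableRel G.Adj] (hn : 0 < n) : degreeFloor G ≤ n := by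
  refine max_le ?_ (by exact_mod_cast minDegree_le_card hn)
  have : (1 : ℝ) ≤ n := by exact_mod_cast hn
  rw [Real.sqrt_le_left (by positivity)]
  nlinarith

theorem one_le_degreeFloor [DecidableRel G.Adj] (hn : 0 < n) : 1 ≤ degreeFloor G :=
  le_max_of_le_left (Real.one_le_sqrt.2 (by exact_mod_cast hn))

/-- The program does not compute `δ`, but its threshold `m` is never below it, so the number of
centres stays of order `K n/δ`. -/
theorem IsDegreeBound.degreeFloor_le [DecidableRel G.Adj] {m : ℕ} (h : IsDegreeBound L n m)
    (hn : 0 < n) : degreeFloor G ≤ m := by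
  rcases h.eq with rfl | ⟨u, hu, hd, rfl⟩
  · exact _root_.degreeFloor_le hn
  · refine max_le ?_ ?_
    · rw [Real.sqrt_le_left (by positivity), sq]
      exact_mod_cast hd
    · rw [L.degQuery_eq_degree ⟨u, hu⟩]
      exact_mod_cast G.minDegree_le_degree _

/-- A node of degree below `√n` forces `δ = √n`, and then `n/δ = √n`. -/
theorem degQuery_le_of_low [DecidableRel G.Adj] {v : ℕ} (hv : v < n)
    (h : L.degQuery v * L.degQuery v < n) : (L.degQuery v : ℝ) ≤ n / degreeFloor G := by
  have h1 : (L.degQuery v : ℝ) ≤ Real.sqrt n := Real.le_sqrt_of_sq_le (by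
    rw [sq]; exact_mod_cast h.le)
  have h2 : (G.minDegree : ℝ) ≤ Real.sqrt n := by
    refine le_trans ?_ h1
    rw [L.degQuery_eq_degree ⟨v, hv⟩]
    exact_mod_cast G.minDegree_le_degree _
  rw [degreeFloor, max_eq_left h2, Real.div_sqrt]
  exact h1

/-- Since `D ≤ n`, `√D ≤ √n ≤ δ`; hence `D/δ ≤ √D`. -/
theorem min_averageDegree_eq [DecidableRel G.Adj] (hn : 0 < n) :
    min (averageDegree G / degreeFloor G) (Real.sqrt (averageDegree G)) =
      averageDegree G / degreeFloor G := by
  refine min_eq_left ?_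
  have h1 := averageDegree_nonneg G
  have h2 : Real.sqrt (averageDegree G) ≤ degreeFloor G :=
    (Real.sqrt_le_sqrt (averageDegree_le G)).trans (le_max_left _ _)
  rw [div_le_iff₀ (by linarith [one_le_degreeFloor (G := G) hn])]
  calc averageDegree G = Real.sqrt (averageDegree G) * Real.sqrt (averageDegree G) :=
        (Real.mul_self_sqrt h1).symm
    _ ≤ _ := by gcongr

/-- Everything reduces to `K N r` and `K N D/δ`. The decisive term is `k D ≤ K (N/δ + 1) D`, whose
second part is at most `K N`. -/
theorem time_bound {N r r' K k S ρ D δ ω sz : ℝ} (hN : 1 ≤ N) (hr : 1 ≤ r) (hr' : r' ≤ 2 * r)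
    (hK : 1 ≤ K) (hω : 1 ≤ ω) (hsz : sz ≤ N) (hδ : 1 ≤ δ) (hk : k ≤ K * (N / δ + 1))
    (hD0 : 0 ≤ D) (hD : D ≤ N) (hS : S ≤ 2 * N * (K + k * (D / N))) (hρ : ρ ≤ 2 * r) :
    8 * (N + r' + 2) + ω * (10 * (sz + 1) + 40 * (N + 1) + 40 * (k + 1) + 80 * (S + k + 1) +
      100 * (N * (K * ρ + 1))) ≤ 1200 * (ω * K) * (N * r + N * (D / δ)) := by
  set X := N * r with hX
  set Y := N * (D / δ) with hY
  have hY0 : 0 ≤ Y := by positivity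
  have hNX : N ≤ X := le_mul_of_one_le_right (by linarith) hr
  have hrX : r ≤ X := le_mul_of_one_le_left (by linarith) hN
  have hP : X ≤ K * X := le_mul_of_one_le_left (by linarith) hK
  have hKN : K * N ≤ K * X := by gcongr
  have hNδ : N / δ ≤ N := div_le_self (by linarith) hδ
  have hk2 : k ≤ 2 * (K * X) := by
    have : K * (N / δ + 1) ≤ K * (N + N) := by gcongr
    linarith
  have hkD : k * D ≤ K * Y + K * X := by
    calc k * D ≤ K * (N / δ + 1) * D := by gcongr
      _ = K * Y + K * D := by rw [hY]; ring
      _ ≤ K * Y + K * X := by gcongr; linarith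
  have hS2 : S ≤ 4 * (K * X) + 2 * (K * Y) := by
    have : 2 * N * (K + k * (D / N)) = 2 * (K * N) + 2 * (k * D) := by
      field_simp
    linarith
  have hR : N * (K * ρ + 1) ≤ 3 * (K * X) := by
    have : N * (K * ρ) ≤ N * (K * (2 * r)) := by gcongr
    have e : N * (K * (2 * r)) = 2 * (K * X) := by rw [hX]; ring
    linarith
  have h1 : 10 * (sz + 1) + 40 * (N + 1) + 40 * (k + 1) + 80 * (S + k + 1) +
      100 * (N * (K * ρ + 1)) ≤ 1080 * (K * X) + 160 * (K * Y) := by linarith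
  have hKX0 : 0 ≤ K * X := by linarith
  have hKY0 : 0 ≤ K * Y := by positivity
  calc _ ≤ 40 * (K * X) + ω * (1080 * (K * X) + 160 * (K * Y)) := by
        have h2 := mul_le_mul_of_nonneg_left h1 (show 0 ≤ ω by linarith)
        linarith
    _ ≤ ω * (40 * (K * X)) + ω * (1080 * (K * X) + 160 * (K * Y)) := by
        have := le_mul_of_one_le_left (show 0 ≤ 40 * (K * X) by linarith) hω
        linarith
    _ ≤ _ := by
        have : 0 ≤ ω * (80 * (K * X) + 1040 * (K * Y)) := by positivity
        linarith

/-- If the parameter was capped at `N`, then `N/ρ ≤ 1 ≤ N/δ`; otherwise `N/ρ ≤ N/r`. -/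
theorem edge_bound {N r K k ρ δ : ℝ} (hN : 1 ≤ N) (hr : 0 < r) (hK : 1 ≤ K) (hδ : 1 ≤ δ)
    (hδN : δ ≤ N) (hk : k ≤ K * (N / δ + 1)) (hρ : min N r ≤ ρ) :
    1 + k + 2 * K * N / ρ ≤ 5 * K * (N / δ + N / r) := by
  have h1 : 1 ≤ N / δ := by rw [le_div_iff₀ (by linarith)]; linarith
  have hρ' : 0 < min N r := lt_min (by linarith) hr
  have h2 : N / ρ ≤ N / δ + N / r := by
    have h3 : N / ρ ≤ N / min N r := by gcongr
    refine h3.trans ?_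
    rcases min_choice N r with h | h
    · rw [h, div_self (by linarith)]
      have : 0 ≤ N / r := by positivity
      linarith
    · rw [h]
      linarith
  have h4 : 2 * K * N / ρ = 2 * K * (N / ρ) := by ring
  have h5 : K * (N / δ + 1) ≤ K * (N / δ + N / δ) := by gcongr
  have h6 : 2 * K * (N / ρ) ≤ 2 * K * (N / δ + N / r) := by gcongr
  have h7 : N / δ ≤ K * (N / δ) := le_mul_of_one_le_left (by linarith) hK
  have h8 : 0 ≤ K * (N / r) := by positivity
  rw [h4]
  linarith

end Bounds

/-! ### Assembly of the theorem. -/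

theorem buildsSpannerOracle_of_one_le {c : ℝ} {A n : ℕ} (hA : c + 4 ≤ A) (hA4 : 4 ≤ A) (hn : 0 < n)
    (G : SimpleGraph (Fin n)) [DecidableRel G.Adj] (L : AdjacencyList G) {r C1 : ℝ} (hr : 1 ≤ r)
    (hC1 : C1 = 2 * Real.log (32 + 8 * A) + 8) :
    BuildsSpannerOracle L (prepCmd A) queryCmd r 3 (1 - 1 / (n : ℝ) ^ c)
      (1200 * A * C1 ^ 2 * Real.log (n + 2) ^ 2 *
        (n * r + n * min (averageDegree G / degreeFloor G) (Real.sqrt (averageDegree G))))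
      (1200 * A * C1 ^ 2 * Real.log (n + 2) ^ 2)
      (1200 * A * C1 ^ 2 * Real.log (n + 2) ^ 2 *
        ((n : ℝ) ^ 2 / degreeFloor G + (n : ℝ) ^ 2 / r)) := by
  classical
  set V := (32 + 8 * A) * (n + 1) ^ 2 with hV
  -- The bound on the numbers also serves as fuel, since no loop makes `V` rounds.
  refine ⟨V, ?_⟩
  -- For `n = 1` the required probability is `1 - 1 = 0`, and `failure_le` needs `n ≥ 2`.
  rcases Nat.lt_or_ge n 2 with hn1 | hn2
  · obtain rfl : n = 1 := by omega
    simp only [Nat.cast_one, Real.one_rpow, div_one, sub_self]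
    exact ENNReal.toReal_nonneg
  set ℓ := Real.log (n + 2) with hℓ
  set ω : ℝ := ((V.size + 1 : ℕ) : ℝ) with hω
  set K := A * n.size with hK
  set δ := degreeFloor G with hδ
  have hωC : ω ≤ C1 * ℓ := by rw [hC1]; exact size_add_one_le A n hn
  have hω1 : 1 ≤ ω := by rw [hω]; push_cast; linarith [(Nat.cast_nonneg V.size : (0 : ℝ) ≤ _)]
  have hA1 : (1 : ℝ) ≤ A := by exact_mod_cast (by omega : 1 ≤ A)
  have hN : (1 : ℝ) ≤ n := by exact_mod_cast hn
  have hK1 : (1 : ℝ) ≤ K := by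
    have h1 := Nat.size_pos.2 hn
    have : 0 < K := Nat.mul_pos (by omega) h1
    exact_mod_cast this
  have hKω : (K : ℝ) ≤ A * ω := by
    have h1 : n.size ≤ V.size := Nat.size_le_size (by rw [hV]; nlinarith [Nat.zero_le (A * (n + 1) ^ 2)])
    have h2 : K ≤ A * (V.size + 1) := Nat.mul_le_mul_left _ (by omega)
    rw [hω]
    exact_mod_cast h2
  have hCℓ : 0 ≤ C1 * ℓ := by linarith
  have hωK : ω * K ≤ A * C1 ^ 2 * ℓ ^ 2 := by
    calc ω * K ≤ ω * (A * ω) := by gcongr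
      _ = A * (ω * ω) := by ring
      _ ≤ A * ((C1 * ℓ) * (C1 * ℓ)) := by gcongr
      _ = _ := by ring
  have hδ1 : 1 ≤ δ := one_le_degreeFloor hn
  have hδn : δ ≤ n := degreeFloor_le hn
  have hceil : r ≤ ⌈r⌉₊ := Nat.le_ceil r
  have hceil2 : (⌈r⌉₊ : ℝ) ≤ 2 * r := by
    have := Nat.ceil_lt_add_one (show 0 ≤ r by linarith)
    linarith
  have hr0 : 0 < ⌈r⌉₊ := Nat.ceil_pos.2 (by linarith)
  refine le_trans (sub_le_sub_left (failure_le hA hn2) 1) ?_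
  refine one_sub_le_prob (by positivity) ?_
  refine wp_prepCmd_le (L := L) (F := V) hn hr0 le_rfl le_rfl
    (fun t => by split_ifs <;> simp) ?_
  intro t mm k hmm hk hmem hsamples hprobes hscan htime
  rw [if_pos]
  have hkK : (k : ℝ) ≤ K * (n / δ + 1) := by
    have h1 : ((n / mm : ℕ) : ℝ) ≤ n / δ := by
      refine Nat.cast_div_le.trans ?_
      have := hmm.degreeFloor_le hn
      gcongr
    have h2 : (K : ℝ) = A * n.size := by rw [hK]; push_cast; rfl
    rw [hk, h2]
    push_cast
    gcongr
  refine ⟨?_, keptGraph G t.mem, ?_, isSpanner_keptGraph hmem, ?_⟩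
  · rw [min_averageDegree_eq hn]
    have h1 := time_bound (N := n) (r := r) (r' := ⌈r⌉₊) (K := K) (k := k)
      (S := (∑ j ∈ Finset.range k, L.degQuery (t.mem (4 * j + 2)) : ℕ)) (ρ := (min n ⌈r⌉₊ : ℕ))
      (D := averageDegree G) (δ := δ) (ω := ω) (sz := n.size) hN hr hceil2 hK1 hω1
      (by exact_mod_cast Nat.size_le.2 Nat.lt_two_pow_self) hδ1 hkK (averageDegree_nonneg G)
      (averageDegree_le G) ?_ ?_
    · have h2 : (t.time : ℝ) ≤ 8 * (n + ⌈r⌉₊ + 2) + ω * (10 * (n.size + 1) + 40 * (n + 1) +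
          40 * (k + 1) + 80 * ((∑ j ∈ Finset.range k, L.degQuery (t.mem (4 * j + 2)) : ℕ) + k + 1) +
          100 * (n * (K * (min n ⌈r⌉₊ : ℕ) + 1))) := by
        rw [hω]
        exact_mod_cast htime
      refine h2.trans (h1.trans ?_)
      have h3 : 1200 * (ω * K) ≤ 1200 * A * C1 ^ 2 * ℓ ^ 2 := by linarith
      have h4 := averageDegree_nonneg G
      gcongr
    · have h3 : (L.degSum : ℝ) / n ^ 2 = averageDegree G / n := by
        rw [averageDegree_eq L, div_div, sq]
      unfold ScanBounded at hscan
      rw [h3] at hscan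
      exact hscan
    · refine le_trans ?_ hceil2
      exact_mod_cast min_le_right _ _
  · have h1 := queryCmd_isAdjacencyOracle (V := V) hmem
      (by rw [hV]; nlinarith [Nat.zero_le (A * (n + 1) ^ 2)])
    refine ⟨h1.1, fun u v => ?_⟩
    obtain ⟨fuel, t', h2, h3, h4⟩ := h1.2 u v
    refine ⟨fuel, t', h2, h3.trans ?_, h4⟩
    have h5 : ω ≤ ω * K := le_mul_of_one_le_right (by linarith) hK1
    have h6 : ((V.size : ℝ) + 1) = ω := by rw [hω]; push_cast; rfl
    rw [h6]
    linarith
  · have h1 := ncard_keptGraph_le (L := L) (K := K) (ρ := min n ⌈r⌉₊) hmem (lt_min hn hr0)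
      hsamples hprobes ?_ (B := 5 * K * (n / δ + n / r)) ?_ ?_
    · refine h1.trans ?_
      have h2 : (n : ℝ) * (5 * K * (n / δ + n / r)) = 5 * K * ((n : ℝ) ^ 2 / δ + (n : ℝ) ^ 2 / r) := by
        ring
      rw [h2]
      have h3 : 5 * (K : ℝ) ≤ 1200 * A * C1 ^ 2 * ℓ ^ 2 := by
        have : (K : ℝ) ≤ ω * K := le_mul_of_one_le_left (by linarith) hω1
        linarith
      gcongr
    · intro u hu hd
      rw [hk]
      have := hmm.le_deg u hu hd
      have := hmm.pos
      gcongr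
    · intro v hv hlow
      refine (degQuery_le_of_low hv hlow).trans ?_
      have h2 : 0 ≤ (n : ℝ) / r := by positivity
      have h3 : 0 ≤ (n : ℝ) / δ := by positivity
      nlinarith
    · refine edge_bound hN (by linarith) hK1 hδ1 hδn hkK ?_
      push_cast
      gcongr

theorem BuildsSpannerOracle.mono {n : ℕ} {G : SimpleGraph (Fin n)} {L : AdjacencyList G}
    {prep query : Cmd} {r : ℝ} {k : ℕ} {p T T' Q Q' M M' : ℝ}
    (h : BuildsSpannerOracle L prep query r k p T Q M) (hT : T ≤ T') (hQ : Q ≤ Q')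
    (hM : M ≤ M') :
    BuildsSpannerOracle L prep query r k p T' Q' M' := by
  obtain ⟨fuel, h⟩ := h
  refine ⟨fuel, h.trans (ENNReal.toReal_mono ?_ (MeasureTheory.OuterMeasure.mono _ ?_))⟩
  · refine ne_top_of_le_ne_top ENNReal.one_ne_top ?_
    rw [PMF.toOuterMeasure_apply, ← PMF.tsum_coe]
    exact ENNReal.tsum_le_tsum fun o => Set.indicator_le_self _ _ _
  · rintro o ⟨s, rfl, h1, H, h2, h3, h4⟩
    refine ⟨s, rfl, h1.trans hT, H, ⟨h2.1, fun u v => ?_⟩, h3, h4.trans hM⟩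
    obtain ⟨fuel, t, h5, h6, h7⟩ := h2.2 u v
    exact ⟨fuel, t, h5, h6.trans hQ, h7⟩

theorem mainTheorem4 (c : ℝ) (hc : 0 < c) :
    ∃ (prep query : Cmd) (C : ℝ) (k : ℕ),
      ∀ (n : ℕ), 0 < n →
      ∀ (G : SimpleGraph (Fin n)) [DecidableRel G.Adj] (L : AdjacencyList G),
        (∀ r : ℝ, 1 ≤ r →
          BuildsSpannerOracle L prep query r 3
            (1 - 1 / (n : ℝ) ^ c)
            (C * Real.log (n + 2) ^ k *
              (n * r + n * min (averageDegree G / degreeFloor G) (Real.sqrt (averageDegree G))))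
            (C * Real.log (n + 2) ^ k)
            (C * Real.log (n + 2) ^ k * ((n : ℝ) ^ 2 / degreeFloor G + (n : ℝ) ^ 2 / r))) ∧
        BuildsSpannerOracle L prep query (Real.sqrt n) 3
          (1 - 1 / (n : ℝ) ^ c)
          (C * Real.log (n + 2) ^ k * (n : ℝ) ^ (3 / 2 : ℝ))
          (C * Real.log (n + 2) ^ k)
          (C * Real.log (n + 2) ^ k * (n : ℝ) ^ (3 / 2 : ℝ)) := by
  set A : ℕ := ⌈c⌉₊ + 4 with hAdef
  have hA : c + 4 ≤ A := by
    rw [hAdef]; push_cast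
    linarith [Nat.le_ceil c]
  set C1 : ℝ := 2 * Real.log (32 + 8 * A) + 8 with hC1
  -- The factor 2 is for the second part, where each of the two terms of a bound is at most `n √n`;
  -- the exponent 2 counts one logarithm from `K` and one from the bit lengths.
  refine ⟨prepCmd A, queryCmd, 2 * (1200 * A * C1 ^ 2), 2, fun n hn G _ L => ?_⟩
  have hN : (1 : ℝ) ≤ n := by exact_mod_cast hn
  have key := fun (r : ℝ) (hr : 1 ≤ r) =>
    buildsSpannerOracle_of_one_le hA (by omega) hn G L hr hC1
  have hδ := one_le_degreeFloor (G := G) hn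
  set E : ℝ := 1200 * A * C1 ^ 2 * Real.log (n + 2) ^ 2 with hE
  have hE0 : 0 ≤ E := by positivity
  have hE2 : 2 * (1200 * A * C1 ^ 2) * Real.log (n + 2) ^ 2 = 2 * E := by rw [hE]; ring
  rw [hE2]
  have hmin : 0 ≤ min (averageDegree G / degreeFloor G) (Real.sqrt (averageDegree G)) :=
    le_min (div_nonneg (averageDegree_nonneg G) (by linarith)) (Real.sqrt_nonneg _)
  have hpow : (n : ℝ) ^ (3 / 2 : ℝ) = n * Real.sqrt n := by
    rw [Real.sqrt_eq_rpow, ← Real.rpow_one_add' (by positivity) (by norm_num)]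
    norm_num
  have hsq : Real.sqrt n * Real.sqrt n = n := Real.mul_self_sqrt (by positivity)
  have hs1 : 1 ≤ Real.sqrt n := Real.one_le_sqrt.2 hN
  refine ⟨fun r hr => (key r hr).mono ?_ (by linarith) ?_, (key _ hs1).mono ?_ (by linarith) ?_⟩
  · gcongr
    linarith
  · gcongr
    linarith
  · have h1 : min (averageDegree G / degreeFloor G) (Real.sqrt (averageDegree G)) ≤ Real.sqrt n :=
      (min_le_right _ _).trans (Real.sqrt_le_sqrt (averageDegree_le G))
    calc _ ≤ E * (n * Real.sqrt n + n * Real.sqrt n) := by gcongr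
      _ = _ := by rw [hpow]; ring
  · have h1 : (n : ℝ) ^ 2 / Real.sqrt n = n * Real.sqrt n := by
      rw [div_eq_iff (by linarith)]
      linear_combination (-(n : ℝ)) * hsq
    have h2 : (n : ℝ) ^ 2 / degreeFloor G ≤ n * Real.sqrt n := by
      rw [← h1]
      gcongr
      exact le_max_left _ _
    calc _ ≤ E * (n * Real.sqrt n + n * Real.sqrt n) := by rw [h1]; gcongr
      _ = _ := by rw [hpow]; ring
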